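/- **The model.** Processes communicate through atomic binary registers (shared cells holding $0$ or $1$). An idle process may invoke an operation; then it takes steps, each consisting of one read or write of one binary register and local computation, and in the last of these steps it returns a response. An execution is a finite or infinite sequence of invocations and steps, arbitrarily interleaved, from the initial configuration. An operation is *pending* if it has been invoked and has not returned; a configuration is *quiescent* if no operation is pending in it. **The algorithm.** Let $K\ge 1$ and $v_0\in\{1,\dots,K\}$. There are one reader and one writer, and the binary registers $A[1..K]$, $B[1..K]$, $\mathit{flag}[1]$, $\mathit{flag}[2]$, all initially $0$ except $A[v_0]=1$. The writer has a private variable $\mathit{last}$, initially $v_0$, that persists between its operations. The reader invokes only $\mathrm{Read}()$, and the writer only $\mathrm{Write}(v)$ with $v\in\{1,\dots,K\}$. $\mathrm{Read}()$: 1. $\mathit{flag}[1]\gets 1$. 2. Perform $val\gets\mathrm{TryRead}()$ and, if it gives $\bot$, perform it a second time. If one of the two calls gives $val\ne\bot$, go to step 4. 3. For $j=1,\dots,K$: if $B[j]=1$ then $val\gets j$. 4. $\mathit{flag}[2]\gets 1$; for $j=1,\dots,K$: $B[j]\gets 0$; then $\mathit{flag}[1]\gets 0$; then $\mathit{flag}[2]\gets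 0$; return $val$. $\mathrm{TryRead}()$: read $A[1],A[2],\dots$ until some $A[j]=1$ is found. If none is found up to $A[K]$, the result is $\bot$. Otherwise let $val=j$ and, for $j'=j-1,\dots,1$, if $A[j']=1$ then $val\gets j'$; the result is $val$. $\mathrm{Write}(v)$: 1. Read $B[1],\dots,B[K]$. If all of them are $0$, read $\mathit{flag}[1]$; if it is $1$, then $B[\mathit{last}]\gets 1$, read $\mathit{flag}[2]$, read $\mathit{flag}[1]$, and if $\mathit{flag}[2]=1$ or $\mathit{flag}[1]=0$ was read then $B[\mathit{last}]\gets 0$. 2. $A[v]\gets 1$; for $j=v-1,\dots,1$: $A[j]\gets 0$; for $j=v+1,\dots,K$: $A[j]\gets 0$. 3. $\mathit{last}\gets v$; return. **Theorem.** This algorithm is a linearizable, wait-free, quiescent history-independent implementation of the single-writer single-reader $K$-valued register with initial value $v_0$ from binary registers. That is: 1. *(Linearizable.)* For every finite or infinite execution there is a sequential history that contains all operations that complete in the execution, with their responses, and possibly some of the pending ones, with suitable responses, that matches the sequential specification of the register (a Read returns the value of the last preceding Write, or $v_0$ if there is none), and in which an operation precedes another one whenever it returned before the other was invoked. Such a sequential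 history is called a linearization of the execution. 2. *(Wait-free.)* Every operation returns within finitely many steps of the process that invoked it, whatever the other process does. 3. *(Quiescent history-independent.)* There is a function $h$ that maps each execution to a linearization of it, such that if $\alpha,\alpha'$ are finite executions that end in quiescent configurations and $h(\alpha)$, $h(\alpha')$ lead to the same register value, then the contents of all binary registers are the same at the end of $\alpha$ and at the end of $\alpha'$. 4. In every quiescent configuration of every execution, $\mathit{flag}[1]=\mathit{flag}[2]=0$ and $B[j]=0$ for all $1\le j\le K$. -/

import Mathlib

namespace HIReg

/-! ## Abstract objects -/

/-- A deterministic abstract object with states `Q`, operations `O` and responses `R`. -/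
structure AbstractObject (Q O R : Type) where
  init : Q
  Δ : Q → O → Q × R

/-! ## Implementations from binary registers, executions -/

/-- The primitive operations on binary registers indexed by `ι`. -/
inductive Prim (ι : Type) where
  | read (i : ι)
  | write (i : ι) (b : Bool)

/-- The value that a primitive returns (a write returns nothing, encoded as `false`). -/
def Prim.result {ι : Type} (m : ι → Bool) : Prim ι → Bool
  | .read i => m i
  | .write _ _ => false

/-- The memory after a primitive. -/
def Prim.effect {ι : Type} [DecidableEq ι] (m : ι → Bool) : Prim ι → ι → Bool
  | .read _ => m
  | .write i b => Function.update m i b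

/-- An implementation, by the processes `P`, of operations `O` with responses `R`, from binary
registers indexed by `ι`. Between operations process `p` is in a local state in `Idle p`, which
holds its persistent private variables; during an operation it is in a local state in `Active p`.
* `start p o s` is the local state of `p` after an invocation of `o`; it is `none` if `p` has no
  program for `o`, and then `p` cannot invoke `o`.
* `prim p a` is the primitive that `p` performs in its next step.
* `next p a b` says how `p` goes on when that primitive has returned `b`: it either continues the
  operation, or returns a response and becomes idle. -/
structure Implementation (P O R ι : Type) where
  Idle : P → Type
  Active : P → Type
  mem₀ : ι → Bool
  idle₀ : ∀ p, Idle p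
  start : ∀ p, O → Idle p → Option (Active p)
  prim : ∀ p, Active p → Prim ι
  next : ∀ p, Active p → Bool → Active p ⊕ (Idle p × R)

/-- What can happen: an invocation of an operation by an idle process, or a step of a process in
its pending operation. -/
inductive Action (P O : Type) where
  | invoke (p : P) (o : O)
  | step (p : P)

section Model

variable {P O R ι : Type}

/-- A configuration: the states of the base objects and of the processes. -/
@[ext]
structure Config (I : Implementation P O R ι) where
  mem : ι → Bool
  loc : ∀ p, I.Idle p ⊕ I.Active p

/-- The initial configuration. -/
def Config.initial (I : Implementation P O R ι) : Config I where
  mem := I.mem₀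
  loc := fun p => Sum.inl (I.idle₀ p)

/-- No operation is pending. -/
def Config.Quiescent {I : Implementation P O R ι} (C : Config I) : Prop :=
  ∀ p, (C.loc p).isLeft

variable [DecidableEq P] [DecidableEq ι]

/-- The configuration after an action, together with the response returned in it, if any;
`none` if the action is not possible in `C`. -/
def Config.perform {I : Implementation P O R ι} (C : Config I) :
    Action P O → Option (Config I × Option R)
  | .invoke p o =>
    match C.loc p with
    | .inl s => (I.start p o s).map fun a =>
        ({ mem := C.mem, loc := Function.update C.loc p (.inr a) }, none)
    | .inr _ => none
  | .step p =>
    match C.loc p with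
    | .inl _ => none
    | .inr a =>
      let m := (I.prim p a).effect C.mem
      match I.next p a ((I.prim p a).result C.mem) with
      | .inl a' => some ({ mem := m, loc := Function.update C.loc p (.inr a') }, none)
      | .inr (s, r) => some ({ mem := m, loc := Function.update C.loc p (.inl s) }, some r)

/-- A finite or infinite execution from the initial configuration. Its `n`-th action leads from
`cfg n` to `cfg (n + 1)` and returns the response `resp n`, if any. A finite execution is
continued by repeating its last configuration, so that it is determined by its actions. -/
structure Execution (I : Implementation P O R ι) where
  actions : Stream'.Seq (Action P O)
  cfg : ℕ → Config I
  resp : ℕ → Option R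
  cfg_zero : cfg 0 = Config.initial I
  cfg_succ : ∀ n a, actions.get? n = some a → (cfg n).perform a = some (cfg (n + 1), resp n)
  cfg_stop : ∀ n, actions.get? n = none → cfg (n + 1) = cfg n ∧ resp n = none

namespace Execution

variable {I : Implementation P O R ι}

/-- The `n`-th action of `α` is an invocation of `o` by `p`. Operations of an execution are
identified by the index of their invocation. -/
def Invokes (α : Execution I) (n : ℕ) (p : P) (o : O) : Prop :=
  α.actions.get? n = some (.invoke p o)

/-- In the `m`-th action of `α` process `p` returns `r`. -/
def Responds (α : Execution I) (m : ℕ) (p : P) (r : R) : Prop :=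
  α.actions.get? m = some (.step p) ∧ α.resp m = some r

/-- The operation invoked in the `n`-th action of `α` returns `r` in the `m`-th action: this is
the first response of the same process after the invocation. -/
def Returns (α : Execution I) (n m : ℕ) (r : R) : Prop :=
  ∃ p o, α.Invokes n p o ∧ n < m ∧ α.Responds m p r ∧
    ∀ l r', n < l → l < m → ¬ α.Responds l p r'

/-- `α` is finite and ends with the configuration `C`. -/
def EndsIn (α : Execution I) (C : Config I) : Prop :=
  ∃ n, α.actions.TerminatedAt n ∧ α.cfg n = C

end Execution

/-! ## Sequential histories and linearizability -/

/-- An invocation of `op` by `proc`, immediately followed by the matching response `resp`. -/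
structure CompleteOp (P O R : Type) where
  proc : P
  op : O
  resp : R

/-- A finite or infinite sequential history. -/
abbrev SeqHistory (P O R : Type) := Stream'.Seq (CompleteOp P O R)

variable {Q : Type}

/-- The state of the object after the first `n` operations of `H` (after all of them, if there
are at most `n`). -/
def stateAfter (Ob : AbstractObject Q O R) (H : SeqHistory P O R) : ℕ → Q
  | 0 => Ob.init
  | n + 1 =>
    match H.get? n with
    | some x => (Ob.Δ (stateAfter Ob H n) x.op).1
    | none => stateAfter Ob H n

/-- The finite sequential history `H` leads from the initial state to the state `q`. -/
def FinalState (Ob : AbstractObject Q O R) (H : SeqHistory P O R) (q : Q) : Prop :=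
  ∃ n, H.TerminatedAt n ∧ stateAfter Ob H n = q

/-- `H` matches the sequential specification of `Ob`. -/
def Legal (Ob : AbstractObject Q O R) (H : SeqHistory P O R) : Prop :=
  ∀ k x, H.get? k = some x → (Ob.Δ (stateAfter Ob H k) x.op).2 = x.resp

/-- The sequential history `H` is a linearization of `α`. Here `f k` is the index in `α` of the
invocation of the `k`-th operation of `H`. The first three conditions say that `H` is a
permutation of a completion of the history of `α`: every operation of `H` is invoked in `α` and
has in `H` its response from `α` if it has one there (a pending operation may be given any
response, or be left out), no operation occurs twice in `H`, and every operation that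
completes in `α` occurs in `H`. -/
def IsLinearization (Ob : AbstractObject Q O R) {I : Implementation P O R ι}
    (α : Execution I) (H : SeqHistory P O R) : Prop :=
  ∃ f : ℕ → ℕ,
    (∀ k x, H.get? k = some x →
      α.Invokes (f k) x.proc x.op ∧ ∀ m r, α.Returns (f k) m r → x.resp = r) ∧
    (∀ k l, ¬ H.TerminatedAt k → ¬ H.TerminatedAt l → f k = f l → k = l) ∧
    (∀ n m r, α.Returns n m r → ∃ k, ¬ H.TerminatedAt k ∧ f k = n) ∧
    Legal Ob H ∧
    -- real-time order of non-overlapping operations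
    (∀ k l m r, ¬ H.TerminatedAt k → ¬ H.TerminatedAt l →
      α.Returns (f k) m r → m < f l → k < l)

/-- All executions, finite and infinite, have a linearization. -/
def Linearizable (Ob : AbstractObject Q O R) (I : Implementation P O R ι) : Prop :=
  ∀ α : Execution I, ∃ H, IsLinearization Ob α H

/-! ## Progress and history independence -/

/-- Every operation returns within finitely many steps of its process: there is no execution in
which a process takes infinitely many steps and yet one of its operations never returns. -/
def WaitFree (I : Implementation P O R ι) : Prop :=
  ∀ (α : Execution I) (n : ℕ) (p : P) (o : O), α.Invokes n p o →
    (∀ N, ∃ m, N ≤ m ∧ α.actions.get? m = some (.step p)) → ∃ m r, α.Returns n m r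

/-- `I` is history independent with respect to a set `E` of finite executions: there is a
linearization function `h` such that any two executions in `E` with the same state according to
`h` end with the same memory. -/
def HIWithRespectTo (Ob : AbstractObject Q O R) (I : Implementation P O R ι)
    (E : Set (Execution I)) : Prop :=
  ∃ h : Execution I → SeqHistory P O R, (∀ α, IsLinearization Ob α (h α)) ∧
    ∀ α ∈ E, ∀ α' ∈ E, ∀ q C C', FinalState Ob (h α) q → FinalState Ob (h α') q →
      α.EndsIn C → α'.EndsIn C' → C.mem = C'.mem

/-- History independence with respect to all finite executions that end with a quiescent
configuration. -/
def QuiescentHI (Ob : AbstractObject Q O R) (I : Implementation P O R ι) : Prop :=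
  HIWithRespectTo Ob I {α | ∃ C, α.EndsIn C ∧ C.Quiescent}

end Model

/-! ## The `K`-valued register -/

inductive RegOp (K : ℕ) where
  | read
  | write (v : Fin K)

/-- Responses: a write is acknowledged, a read returns a value. The response `value none` stands
for a read that returns `⊥`; the register itself never gives it. -/
inductive RegResp (K : ℕ) where
  | ack
  | value (v : Option (Fin K))

/-- The `K`-valued register with initial value `v₀`; its values `1, …, K` are here the elements
`0, …, K - 1` of `Fin K`. -/
def register (K : ℕ) (v₀ : Fin K) : AbstractObject (Fin K) (RegOp K) (RegResp K) where
  init := v₀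
  Δ := fun q o =>
    match o with
    | .read => (q, .value (some q))
    | .write v => (v, .ack)

/-! ## The algorithm -/

/-- The reader and the writer. -/
inductive Proc where
  | reader
  | writer
  deriving DecidableEq

/-- The binary registers: arrays `A` and `B` of size `K`, and two flags. -/
inductive Cell (K : ℕ) where
  | A (j : Fin K)
  | B (j : Fin K)
  | flag1
  | flag2
  deriving DecidableEq

/-- The next index in an upward loop, `none` at the end. -/
def up {K : ℕ} (j : Fin K) : Option (Fin K) :=
  if h : j.val + 1 < K then some ⟨j.val + 1, h⟩ else none

/-- The next index in a downward loop, `none` at the end. -/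
def down {K : ℕ} (j : Fin K) : Option (Fin K) :=
  if 0 < j.val then some ⟨j.val - 1, lt_of_le_of_lt (Nat.sub_le _ _) j.isLt⟩ else none

/-- The local states of the reader in a Read operation, named after the primitive that comes
next; `val` is the value to be returned, `none` being `⊥`. -/
inductive ReaderPC (K : ℕ) where
  /-- `flag[1] ← 1` -/
  | raise1
  /-- upward scan of TryRead, about to read `A[j]`; `second` tells the second TryRead
  from the first -/
  | scanUp (second : Bool) (j : Fin K)
  /-- downward scan of TryRead, about to read `A[j]` -/
  | scanDown (val : Fin K) (j : Fin K)
  /-- both TryReads have returned `⊥`, about to read `B[j]` -/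
  | readB (val : Option (Fin K)) (j : Fin K)
  /-- `flag[2] ← 1` -/
  | raise2 (val : Option (Fin K))
  /-- `B[j] ← 0` -/
  | clearB (val : Option (Fin K)) (j : Fin K)
  /-- `flag[1] ← 0` -/
  | lower1 (val : Option (Fin K))
  /-- `flag[2] ← 0`, then return `val` -/
  | lower2 (val : Option (Fin K))

def ReaderPC.prim {K : ℕ} : ReaderPC K → Prim (Cell K)
  | .raise1 => .write .flag1 true
  | .scanUp _ j => .read (.A j)
  | .scanDown _ j => .read (.A j)
  | .readB _ j => .read (.B j)
  | .raise2 _ => .write .flag2 true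
  | .clearB _ j => .write (.B j) false
  | .lower1 _ => .write .flag1 false
  | .lower2 _ => .write .flag2 false

def ReaderPC.next {K : ℕ} [NeZero K] :
    ReaderPC K → Bool → ReaderPC K ⊕ (Unit × RegResp K)
  | .raise1, _ => .inl (.scanUp false 0)
  | .scanUp _ j, true =>
    match down j with
    | some i => .inl (.scanDown j i)
    | none => .inl (.raise2 (some j))
  | .scanUp second j, false =>
    match up j with
    | some i => .inl (.scanUp second i)
    | none => if second then .inl (.readB none 0) else .inl (.scanUp true 0)
  | .scanDown val j, b =>
    let val' := if b then j else val
    match down j with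
    | some i => .inl (.scanDown val' i)
    | none => .inl (.raise2 (some val'))
  | .readB val j, b =>
    let val' := if b then some j else val
    match up j with
    | some i => .inl (.readB val' i)
    | none => .inl (.raise2 val')
  | .raise2 val, _ => .inl (.clearB val 0)
  | .clearB val j, _ =>
    match up j with
    | some i => .inl (.clearB val i)
    | none => .inl (.lower1 val)
  | .lower1 val, _ => .inl (.lower2 val)
  | .lower2 val, _ => .inr ((), .value val)

/-- The control points of the writer in a Write operation. -/
inductive WriterPC (K : ℕ) where
  /-- about to read `B[j]`; `empty` tells whether all cells of `B` read before were 0 -/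
  | checkB (empty : Bool) (j : Fin K)
  /-- about to read `flag[1]`, having found `B` empty -/
  | checkFlag1
  /-- `B[last-val] ← 1` -/
  | setB
  /-- about to read `flag[2]` -/
  | recheckFlag2
  /-- about to read `flag[1]`, having read `f2` from `flag[2]` -/
  | recheckFlag1 (f2 : Bool)
  /-- `B[last-val] ← 0` -/
  | unsetB
  /-- `A[v] ← 1` -/
  | setA
  /-- downward loop, `A[j] ← 0` -/
  | clearDown (j : Fin K)
  /-- upward loop, `A[j] ← 0` -/
  | clearUp (j : Fin K)

/-- The local state of the writer in Write(`v`); `last` is its persistent variable `last-val`. -/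
structure WriterState (K : ℕ) where
  last : Fin K
  v : Fin K
  pc : WriterPC K

def WriterState.prim {K : ℕ} (s : WriterState K) : Prim (Cell K) :=
  match s.pc with
  | .checkB _ j => .read (.B j)
  | .checkFlag1 => .read .flag1
  | .setB => .write (.B s.last) true
  | .recheckFlag2 => .read .flag2
  | .recheckFlag1 _ => .read .flag1
  | .unsetB => .write (.B s.last) false
  | .setA => .write (.A s.v) true
  | .clearDown j => .write (.A j) false
  | .clearUp j => .write (.A j) false

/-- The writer goes on at the control point `pc`. -/
def WriterState.goto {K : ℕ} (s : WriterState K) (pc : WriterPC K) :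
    WriterState K ⊕ (Fin K × RegResp K) :=
  .inl { s with pc := pc }

/-- The upward loop over the indices from `j` on; when it is finished, the writer sets
`last-val` to `v` and returns. -/
def WriterState.gotoUp {K : ℕ} (s : WriterState K) (j : Option (Fin K)) :
    WriterState K ⊕ (Fin K × RegResp K) :=
  match j with
  | some i => s.goto (.clearUp i)
  | none => .inr (s.v, .ack)

/-- The downward loop over the indices from `j` on; when it is finished, the upward loop
starts. -/
def WriterState.gotoDown {K : ℕ} (s : WriterState K) (j : Option (Fin K)) :
    WriterState K ⊕ (Fin K × RegResp K) :=
  match j with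
  | some i => s.goto (.clearDown i)
  | none => s.gotoUp (up s.v)

def WriterState.next {K : ℕ} (s : WriterState K) (b : Bool) :
    WriterState K ⊕ (Fin K × RegResp K) :=
  match s.pc with
  | .checkB empty j =>
    let empty' := empty && !b
    match up j with
    | some i => s.goto (.checkB empty' i)
    | none => if empty' then s.goto .checkFlag1 else s.goto .setA
  | .checkFlag1 => if b then s.goto .setB else s.goto .setA
  | .setB => s.goto .recheckFlag2
  | .recheckFlag2 => s.goto (.recheckFlag1 b)
  | .recheckFlag1 f2 => if f2 || !b then s.goto .unsetB else s.goto .setA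
  | .unsetB => s.goto .setA
  | .setA => s.gotoDown (down s.v)
  | .clearDown j => s.gotoDown (down j)
  | .clearUp j => s.gotoUp (up j)

/-- The private variables between operations: none for the reader, `last-val` for the writer. -/
def AlgIdle (K : ℕ) : Proc → Type
  | .reader => Unit
  | .writer => Fin K

def AlgActive (K : ℕ) : Proc → Type
  | .reader => ReaderPC K
  | .writer => WriterState K

/-- The wait-free single-writer single-reader `K`-valued register from binary registers. -/
def algorithm (K : ℕ) [NeZero K] (v₀ : Fin K) :
    Implementation Proc (RegOp K) (RegResp K) (Cell K) where
  Idle := AlgIdle K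
  Active := AlgActive K
  mem₀ := fun c => decide (c = .A v₀)
  idle₀ := fun p =>
    match p with
    | .reader => ()
    | .writer => v₀
  start := fun p o s =>
    match p, o, s with
    | .reader, .read, _ => some ReaderPC.raise1
    | .writer, .write v, last => some (WriterState.mk last v (.checkB true 0))
    | .reader, .write _, _ => none
    | .writer, .read, _ => none
  prim := fun p a =>
    match p, a with
    | .reader, a => ReaderPC.prim a
    | .writer, a => WriterState.prim a
  next := fun p a b =>
    match p, a with
    | .reader, a => ReaderPC.next a b
    | .writer, a => WriterState.next a b

end HIReg

/-! The value of the register is taken to be the least index of a cell of `A` that holds 1,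
expressed by `currentValue` through the writer's local state. A Write of `v` changes it in one step:
at `A[v] ← 1` if `v ≤ last`, and otherwise when `A[last]` is cleared. That step is the linearization
point of the Write. A Read may be linearized at any moment of its interval when the register had the
value returned, so correctness of Reads reduces to this: the value returned was the register's value
at some time during the Read (`responds_reader`).

This is part of an inductive invariant `Inv`, relative to the set `S` of values seen so far by the
pending Read. A TryRead that succeeds returns a seen value. A 1 left over in `A` above a smaller new
value is the old value, and the new value was written after the upward scan had passed it
(`LoweredSeen`). A 1 set in advance by a Write of a larger value either becomes current before the
downward scan ends, or the downward scan meets the old value and replaces it (`Rising`).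

If both TryReads fail, `B` must help. Some cell of `A` always holds 1 (`target`), and it moves only
at `A[v] ← 1`; hence a failed scan means that this step occurred during the scan. After that step in
the first scan, every later Write meets `flag[1] = 1` and `flag[2] = 0`, so it leaves some `B[i] =
1` before its own `A[v] ← 1` (`Helping`). The second failure thus guarantees a set cell of `B`,
which nobody clears until the Read has found it, and all set cells of `B` carry seen values.

History independence follows from the clause of `Inv` on `B`: a set cell will be cleared by the
pending Read or is about to be reset by the writer unless a Read that will clear it intervenes. With
no operation pending only `A[value]` is 1. The final state of the linearization is the eventual
value, so it determines the memory. Wait-freedom comes from a rank that decreases with each step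
inside an operation. -/

namespace HIReg

/-! ### Linearizations from linearization points, and wait-freedom from ranks -/

section Generic

variable {P O R ι Q : Type}

theorem stateAfter_of_terminatedAt (Ob : AbstractObject Q O R) (H : SeqHistory P O R) {a b : ℕ}
    (ha : H.TerminatedAt a) (hab : a ≤ b) : stateAfter Ob H b = stateAfter Ob H a := by
  induction b, hab using Nat.le_induction with
  | base => rfl
  | succ b hb ih =>
    have hn : H.get? b = none := Stream'.Seq.terminated_stable H hb ha
    rw [stateAfter, hn]
    exact ih

/-- The sequential history that lists, in increasing order of keys, the operations found at the
keys satisfying `p`. -/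
noncomputable def historyOfKeys (p : ℕ → Prop) (x : ℕ → CompleteOp P O R) :
    SeqHistory P O R := by
  classical
  -- The condition is vacuous when there are infinitely many keys, and otherwise bounds `k` by their
  -- number; this is the range where `Nat.nth` is meaningful.
  exact ⟨fun k => if ∀ hf : (Set.ofPred p).Finite, k < hf.toFinset.card then some (x (Nat.nth p k))
    else none, by
      intro k hk
      by_contra hk'
      have h : ∀ hf : (Set.ofPred p).Finite, k + 1 < hf.toFinset.card := by
        by_contra h
        exact hk' (if_neg h)
      have h' : ∀ hf : (Set.ofPred p).Finite, k < hf.toFinset.card :=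
        fun hf => (Nat.lt_succ_self k).trans (h hf)
      change (if _ then _ else _) = none at hk
      rw [if_pos h'] at hk
      cases hk⟩

section Keys

variable {p : ℕ → Prop} {x : ℕ → CompleteOp P O R}

theorem historyOfKeys_get?_of_lt {k : ℕ} (h : ∀ hf : (Set.ofPred p).Finite, k < hf.toFinset.card) :
    (historyOfKeys p x).get? k = some (x (Nat.nth p k)) := by
  classical
  exact if_pos h

theorem historyOfKeys_terminatedAt {k : ℕ} :
    (historyOfKeys p x).TerminatedAt k ↔ ¬ ∀ hf : (Set.ofPred p).Finite, k < hf.toFinset.card := by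
  classical
  constructor
  · intro h h'
    have := historyOfKeys_get?_of_lt (x := x) h'
    rw [Stream'.Seq.TerminatedAt] at h
    rw [h] at this
    cases this
  · intro h
    exact if_neg h

theorem lt_card_count [DecidablePred p] {κ : ℕ} (h : p κ) (hf : (Set.ofPred p).Finite) :
    Nat.count p κ < hf.toFinset.card := by
  obtain ⟨n, hn, rfl⟩ := Nat.exists_lt_card_nth_eq h
  rw [Nat.count_nth hn]
  exact hn hf

/-- Exactly `Nat.count p κ` operations have keys below `κ`, so a trajectory that moves only at keys
is tracked by the history. -/
theorem stateAfter_historyOfKeys [DecidablePred p] (Ob : AbstractObject Q O R) {state : ℕ → Q}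
    (h0 : state 0 = Ob.init) (hn : ∀ κ, ¬ p κ → state (κ + 1) = state κ)
    (hp : ∀ κ, p κ → Ob.Δ (state κ) (x κ).op = (state (κ + 1), (x κ).resp)) (κ : ℕ) :
    stateAfter Ob (historyOfKeys p x) (Nat.count p κ) = state κ := by
  induction κ with
  | zero => simp [stateAfter, h0]
  | succ κ ih =>
    by_cases h : p κ
    · rw [Nat.count_succ, if_pos h, stateAfter,
        historyOfKeys_get?_of_lt (fun hf => lt_card_count h hf), Nat.nth_count h]
      simp only [ih, hp κ h]
    · rw [Nat.count_succ, if_neg h, add_zero, ih, hn κ h]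

end Keys

variable [DecidableEq P] [DecidableEq ι]

/-- Linearization points: if the operations of `α` that take effect have distinct keys that lie in
their intervals (`2 * t` and `2 * t + 1` standing for the `t`-th configuration and the `t`-th
action), and applying them in the order of their keys follows `state`, then `α` has a
linearization, whose final state is the eventual value of `state`. -/
theorem exists_isLinearization_of_points (Ob : AbstractObject Q O R) {I : Implementation P O R ι}
    (α : Execution I) (Pt : ℕ → ℕ → CompleteOp P O R → Prop) (state : ℕ → Q)
    (h0 : state 0 = Ob.init)
    (hn : ∀ κ, (¬ ∃ n x, Pt κ n x) → state (κ + 1) = state κ)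
    (hp : ∀ κ n x, Pt κ n x → Ob.Δ (state κ) x.op = (state (κ + 1), x.resp))
    (hinv : ∀ κ n x, Pt κ n x → α.Invokes n x.proc x.op)
    (hresp : ∀ κ n x m r, Pt κ n x → α.Returns n m r → x.resp = r)
    (huniq : ∀ κ n x n' x', Pt κ n x → Pt κ n' x' → n = n')
    (hinj : ∀ κ κ' n x x', Pt κ n x → Pt κ' n x' → κ = κ')
    (hret : ∀ n m r, α.Returns n m r → ∃ κ x, Pt κ n x)
    (hlow : ∀ κ n x, Pt κ n x → 2 * n < κ)
    (hhigh : ∀ κ n x m r, Pt κ n x → α.Returns n m r → κ ≤ 2 * m + 1) :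
    ∃ H, IsLinearization Ob α H ∧
      ∀ q, FinalState Ob H q → ∃ N, ∀ κ, N ≤ κ → state κ = q := by
  classical
  -- A total choice of an operation for each key needs a default, available only if some point
  -- exists; without points the empty history works.
  by_cases hne : ∃ κ n x, Pt κ n x
  swap
  · have hs : ∀ κ, state κ = Ob.init := by
      intro κ
      induction κ with
      | zero => exact h0
      | succ κ ih => rw [hn κ (fun h => hne ⟨κ, h⟩), ih]
    have hnil : ∀ k, (Stream'.Seq.nil : SeqHistory P O R).get? k = none := fun k => rfl
    refine ⟨Stream'.Seq.nil, ⟨id, ?_, ?_, ?_, ?_, ?_⟩, ?_⟩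
    · intro k x hx
      rw [hnil] at hx
      cases hx
    · intro k l hk
      exact absurd (hnil k) hk
    · intro n m r h
      obtain ⟨κ, x, h⟩ := hret n m r h
      exact absurd ⟨κ, n, x, h⟩ hne
    · intro k x hx
      rw [hnil] at hx
      cases hx
    · intro k l m r hk
      exact absurd (hnil k) hk
    · rintro q ⟨n, -, rfl⟩
      refine ⟨0, fun κ _ => ?_⟩
      rw [hs, stateAfter_of_terminatedAt Ob _ (hnil 0) (Nat.zero_le n)]
      rfl
  obtain ⟨κ₀, n₀, x₀, -⟩ := hne
  let p : ℕ → Prop := fun κ => ∃ n x, Pt κ n x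
  have hch : ∀ κ, ∃ nx : ℕ × CompleteOp P O R, p κ → Pt κ nx.1 nx.2 := by
    intro κ
    by_cases h : p κ
    · obtain ⟨n, x, h⟩ := h
      exact ⟨(n, x), fun _ => h⟩
    · exact ⟨(n₀, x₀), fun h' => absurd h' h⟩
  choose g hg using hch
  let H : SeqHistory P O R := historyOfKeys p fun κ => (g κ).2
  have hst : ∀ κ, stateAfter Ob H (Nat.count p κ) = state κ :=
    stateAfter_historyOfKeys Ob h0 hn fun κ h => hp κ _ _ (hg κ h)
  have hterm : ∀ {k}, ¬ H.TerminatedAt k ↔ ∀ hf : (Set.ofPred p).Finite, k < hf.toFinset.card :=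
    fun {k} => by rw [historyOfKeys_terminatedAt, not_not]
  have hget : ∀ {k}, ¬ H.TerminatedAt k → H.get? k = some (g (Nat.nth p k)).2 :=
    fun h => historyOfKeys_get?_of_lt (hterm.1 h)
  have hpt : ∀ {k}, ¬ H.TerminatedAt k →
      Pt (Nat.nth p k) (g (Nat.nth p k)).1 (g (Nat.nth p k)).2 :=
    fun h => hg _ (Nat.nth_mem _ (hterm.1 h))
  have hsome : ∀ {k x}, H.get? k = some x → ¬ H.TerminatedAt k ∧ x = (g (Nat.nth p k)).2 := by
    intro k x hx
    have h : ¬ H.TerminatedAt k := by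
      intro h
      rw [Stream'.Seq.TerminatedAt, hx] at h
      cases h
    rw [hget h] at hx
    exact ⟨h, (Option.some.inj hx).symm⟩
  refine ⟨H, ⟨fun k => (g (Nat.nth p k)).1, ?_, ?_, ?_, ?_, ?_⟩, ?_⟩
  · intro k x hx
    obtain ⟨h, rfl⟩ := hsome hx
    exact ⟨hinv _ _ _ (hpt h), fun m r hr => hresp _ _ _ m r (hpt h) hr⟩
  · intro k l hk hl hkl
    have h1 := hpt hk
    have h2 := hpt hl
    simp only at hkl
    rw [hkl] at h1
    have h3 := hinj _ _ _ _ _ h1 h2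
    rw [← Nat.count_nth (hterm.1 hk), ← Nat.count_nth (hterm.1 hl), h3]
  · intro n m r h
    obtain ⟨κ, x, hx⟩ := hret n m r h
    have hpκ : p κ := ⟨n, x, hx⟩
    obtain ⟨k, hk, rfl⟩ := Nat.exists_lt_card_nth_eq hpκ
    exact ⟨k, hterm.2 hk, huniq _ _ _ _ _ (hg _ hpκ) hx⟩
  · intro k x hx
    obtain ⟨h, rfl⟩ := hsome hx
    have h1 := hst (Nat.nth p k)
    rw [Nat.count_nth (hterm.1 h)] at h1
    rw [h1, hp _ _ _ (hpt h)]
  · intro k l m r hk hl hr hml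
    have h1 := hhigh _ _ _ m r (hpt hk) hr
    have h2 := hlow _ _ _ (hpt hl)
    -- The response bounds the key of the `k`-th operation by `2 * m + 1`, while the invocation
    -- after `m` puts the key of the `l`-th above `2 * m + 2`; the enumeration of keys is
    -- increasing.
    by_contra hkl
    have h3 : Nat.nth p l ≤ Nat.nth p k := by
      rcases (not_lt.1 hkl).lt_or_eq with h | h
      · exact (Nat.nth_lt_nth' h (hterm.1 hk)).le
      · rw [h]
    simp only at hml
    omega
  · rintro q ⟨n, hn', rfl⟩
    have hfin : (Set.ofPred p).Finite := by
      by_contra hf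
      exact (not_not.2 hn') (hterm.2 fun hf' => absurd hf' hf)
    obtain ⟨N, hN⟩ := hfin.bddAbove
    -- Beyond the largest key all operations have been counted, so the trajectory has reached the
    -- final state.
    refine ⟨N + 1, fun κ hκ => ?_⟩
    have hT : H.TerminatedAt (Nat.count p κ) := by
      by_contra hT
      have hT' := hterm.1 hT
      have h1 : Nat.nth p (Nat.count p κ) < κ :=
        lt_of_le_of_lt (hN (Nat.nth_mem _ hT')) hκ
      have h2 := Nat.count_strict_mono (Nat.nth_mem _ hT') h1
      rw [Nat.count_nth hT'] at h2
      exact lt_irrefl _ h2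
    rw [← hst κ]
    rcases le_total n (Nat.count p κ) with h | h
    · exact stateAfter_of_terminatedAt Ob H hn' h
    · exact (stateAfter_of_terminatedAt Ob H hT h).symm

/-- What an action can do to a process with a pending operation. -/
theorem Execution.active_cases {I : Implementation P O R ι} (α : Execution I) {t : ℕ} {p : P}
    {a : I.Active p} (ha : (α.cfg t).loc p = .inr a) :
    (α.actions.get? t ≠ some (.step p) ∧ (α.cfg (t + 1)).loc p = .inr a) ∨
    (∃ m a', I.next p a ((I.prim p a).result m) = .inl a' ∧
      (α.cfg (t + 1)).loc p = .inr a' ∧ α.resp t = none) ∨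
    (∃ s r, (α.cfg (t + 1)).loc p = .inl s ∧ α.Responds t p r) := by
  cases hact : α.actions.get? t with
  | none =>
    left
    rw [(Execution.cfg_stop α t hact).1]
    exact ⟨by simp, ha⟩
  | some act =>
    have hs := α.cfg_succ t _ hact
    cases act with
    | invoke p' o =>
      left
      refine ⟨by simp, ?_⟩
      simp only [Config.perform] at hs
      by_cases hp : p' = p
      · subst hp
        rw [ha] at hs
        cases hs
      · split at hs
        · simp only [Option.map_eq_some_iff, Prod.mk.injEq] at hs
          obtain ⟨a', -, hs, -⟩ := hs
          rw [← hs]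
          simp [Function.update_of_ne (Ne.symm hp), ha]
        · cases hs
    | step p' =>
      by_cases hp : p' = p
      · subst hp
        right
        simp only [Config.perform, ha] at hs
        cases hnext : I.next p' a ((I.prim p' a).result (α.cfg t).mem) with
        | inl a' =>
          left
          rw [hnext] at hs
          simp only [Option.some.injEq, Prod.mk.injEq] at hs
          exact ⟨_, a', hnext, by rw [← hs.1]; simp, hs.2.symm⟩
        | inr sr =>
          right
          obtain ⟨s, r⟩ := sr
          rw [hnext] at hs
          simp only [Option.some.injEq, Prod.mk.injEq] at hs
          exact ⟨s, r, by rw [← hs.1]; simp, hact, hs.2.symm⟩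
      · left
        refine ⟨by simpa using hp, ?_⟩
        simp only [Config.perform] at hs
        split at hs
        · cases hs
        · split at hs <;>
          · simp only [Option.some.injEq, Prod.mk.injEq] at hs
            rw [← hs.1]
            simp [Function.update_of_ne (Ne.symm hp), ha]

theorem Execution.Invokes.loc {I : Implementation P O R ι} {α : Execution I} {n : ℕ} {p : P}
    {o : O} (h : α.Invokes n p o) : ∃ s a, (α.cfg n).loc p = .inl s ∧ I.start p o s = some a ∧
      (α.cfg (n + 1)).loc p = .inr a := by
  have hs := α.cfg_succ n _ h
  simp only [Config.perform] at hs
  split at hs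
  · rename_i s hl
    simp only [Option.map_eq_some_iff, Prod.mk.injEq] at hs
    obtain ⟨a, ha, hs, -⟩ := hs
    exact ⟨s, a, hl, ha, by rw [← hs]; simp⟩
  · cases hs

/-- A process is in its operation from the invocation until it responds. -/
theorem Execution.Invokes.active {I : Implementation P O R ι} {α : Execution I} {n m : ℕ} {p : P}
    {o : O} (h : α.Invokes n p o) (hno : ∀ l r, n < l → l < m → ¬ α.Responds l p r) {t : ℕ}
    (hnt : n < t) (htm : t ≤ m) : ∃ a, (α.cfg t).loc p = .inr a := by
  induction t, hnt using Nat.le_induction with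
  | base =>
    obtain ⟨s, a, -, -, ha⟩ := h.loc
    exact ⟨a, ha⟩
  | succ t hnt ih =>
    obtain ⟨a, ha⟩ := ih (by omega)
    rcases α.active_cases ha with h1 | ⟨b, a', -, h1, -⟩ | ⟨s, r, -, h1⟩
    · exact ⟨a, h1.2⟩
    · exact ⟨a', h1⟩
    · exact absurd h1 (hno t r hnt htm)

/-- An implementation is wait-free if some rank of the local states decreases with each step that
does not return. -/
theorem waitFree_of_rank (I : Implementation P O R ι) (rank : ∀ p, I.Active p → ℕ)
    (hrank : ∀ p a m a', I.next p a ((I.prim p a).result m) = .inl a' → rank p a' < rank p a) :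
    WaitFree I := by
  intro α n p o hn hinf
  -- Outer induction on a bound for the rank; inner induction on the distance `d` to the next step
  -- of `p`, since other processes may act in between.
  have key : ∀ k t a, n < t → (α.cfg t).loc p = .inr a → rank p a < k →
      (∀ l r, n < l → l < t → ¬ α.Responds l p r) → ∃ m r, α.Returns n m r := by
    intro k
    induction k with
    | zero => intro t a _ _ h; exact absurd h (Nat.not_lt_zero _)
    | succ k ih =>
      intro t a hnt ha hk hno
      obtain ⟨d, hd⟩ : ∃ d, α.actions.get? (t + d) = some (.step p) := by
        obtain ⟨m, hm, h⟩ := hinf t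
        exact ⟨m - t, by rwa [Nat.add_sub_cancel' hm]⟩
      induction d generalizing t with
      | zero =>
        rcases α.active_cases ha with h1 | ⟨b, a', hb, h1, h2⟩ | ⟨s, r, -, h1⟩
        · exact absurd hd h1.1
        · refine ih (t + 1) a' (by omega) h1 (by have := hrank _ _ _ _ hb; omega) ?_
          intro l r hl hlt h
          rcases Nat.lt_succ_iff_lt_or_eq.1 hlt with h3 | rfl
          · exact hno l r hl h3 h
          · rw [h.2] at h2
            cases h2
        · exact ⟨t, r, p, o, hn, hnt, h1, hno⟩
      | succ d ihd =>
        rcases α.active_cases ha with h1 | ⟨b, a', hb, h1, h2⟩ | ⟨s, r, -, h1⟩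
        · refine ihd (t + 1) (by omega) h1.2 ?_ (by rw [← hd]; congr 1; omega)
          intro l r hl hlt h
          rcases Nat.lt_succ_iff_lt_or_eq.1 hlt with h3 | rfl
          · exact hno l r hl h3 h
          · exact h1.1 h.1
        · refine ih (t + 1) a' (by omega) h1 (by have := hrank _ _ _ _ hb; omega) ?_
          intro l r hl hlt h
          rcases Nat.lt_succ_iff_lt_or_eq.1 hlt with h3 | rfl
          · exact hno l r hl h3 h
          · rw [h.2] at h2
            cases h2
        · exact ⟨t, r, p, o, hn, hnt, h1, hno⟩
  obtain ⟨s, a, -, -, ha⟩ := hn.loc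
  exact key _ (n + 1) a (Nat.lt_succ_self n) ha (Nat.lt_succ_self _) (by intros; omega)

end Generic

end HIReg

namespace HIReg

/-! ### Loop indices -/

variable {K : ℕ}

theorem up_eq_some {j i : Fin K} : up j = some i ↔ i.val = j.val + 1 := by
  unfold up
  split_ifs with h
  · rw [Option.some.injEq, Fin.ext_iff]
    exact eq_comm
  · have := i.isLt
    simp only [false_iff]
    omega

theorem up_eq_none {j : Fin K} : up j = none ↔ j.val + 1 = K := by
  unfold up
  have := j.isLt
  split_ifs with h
  · simp only [false_iff]
    omega
  · simp only [true_iff]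
    omega

theorem down_eq_some {j i : Fin K} : down j = some i ↔ i.val + 1 = j.val := by
  unfold down
  split_ifs with h
  · rw [Option.some.injEq, Fin.ext_iff]
    constructor
    · intro h'; simp only at h'; omega
    · intro h'; simp only; omega
  · simp only [false_iff]
    omega

theorem down_eq_none {j : Fin K} : down j = none ↔ j.val = 0 := by
  unfold down
  split_ifs with h
  · simp only [false_iff]
    omega
  · simp only [true_iff]
    omega

/-! ## Wait-freedom -/

/-- The remaining number of steps, overestimated: each loop gets a block of about `K` values below
those of the phases that precede it. -/
def ReaderPC.rank : ReaderPC K → ℕ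
  | .raise1 => 4 * K + 6
  | .scanUp b j => (if b then 2 * K + 4 else 3 * K + 5) + (K - j)
  | .scanDown _ j => K + 4 + j
  | .readB _ j => K + 3 + (K - j)
  | .raise2 _ => K + 3
  | .clearB _ j => 2 + (K - j)
  | .lower1 _ => 2
  | .lower2 _ => 1

def WriterState.rank (s : WriterState K) : ℕ :=
  match s.pc with
  | .checkB _ j => 2 * K + 6 + (K - j)
  | .checkFlag1 => 2 * K + 6
  | .setB => 2 * K + 5
  | .recheckFlag2 => 2 * K + 4
  | .recheckFlag1 _ => 2 * K + 3
  | .unsetB => 2 * K + 2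
  | .setA => 2 * K + 1
  | .clearDown j => K + 1 + j
  | .clearUp j => K - j

/-! ## The steps of the reader and of the writer -/

/-- The step of the reader at the control point `a` in memory `m` leads to the memory and the
local state that follow, with the given response. -/
inductive ReaderStep [NeZero K] (m : Cell K → Bool) :
    ReaderPC K → (Cell K → Bool) → Unit ⊕ ReaderPC K → Option (RegResp K) → Prop
  | raise1 : ReaderStep m .raise1 (Function.update m .flag1 true) (.inr (.scanUp false 0)) none
  | scanUp_down (b) (j i : Fin K) (h : m (.A j) = true) (hi : i.val + 1 = j.val) :
      ReaderStep m (.scanUp b j) m (.inr (.scanDown j i)) none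
  | scanUp_found (b) (j : Fin K) (h : m (.A j) = true) (hj : j.val = 0) :
      ReaderStep m (.scanUp b j) m (.inr (.raise2 (some j))) none
  | scanUp_next (b) (j i : Fin K) (h : m (.A j) = false) (hi : i.val = j.val + 1) :
      ReaderStep m (.scanUp b j) m (.inr (.scanUp b i)) none
  | scanUp_again (j : Fin K) (h : m (.A j) = false) (hj : j.val + 1 = K) :
      ReaderStep m (.scanUp false j) m (.inr (.scanUp true 0)) none
  | scanUp_fail (j : Fin K) (h : m (.A j) = false) (hj : j.val + 1 = K) :
      ReaderStep m (.scanUp true j) m (.inr (.readB none 0)) none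
  | scanDown_next (x j i : Fin K) (hi : i.val + 1 = j.val) :
      ReaderStep m (.scanDown x j) m (.inr (.scanDown (if m (.A j) then j else x) i)) none
  | scanDown_last (x j : Fin K) (hj : j.val = 0) :
      ReaderStep m (.scanDown x j) m (.inr (.raise2 (some (if m (.A j) then j else x)))) none
  | readB_next (x) (j i : Fin K) (hi : i.val = j.val + 1) :
      ReaderStep m (.readB x j) m (.inr (.readB (if m (.B j) then some j else x) i)) none
  | readB_last (x) (j : Fin K) (hj : j.val + 1 = K) :
      ReaderStep m (.readB x j) m (.inr (.raise2 (if m (.B j) then some j else x))) none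
  | raise2 (x) : ReaderStep m (.raise2 x) (Function.update m .flag2 true) (.inr (.clearB x 0)) none
  | clearB_next (x) (j i : Fin K) (hi : i.val = j.val + 1) :
      ReaderStep m (.clearB x j) (Function.update m (.B j) false) (.inr (.clearB x i)) none
  | clearB_last (x) (j : Fin K) (hj : j.val + 1 = K) :
      ReaderStep m (.clearB x j) (Function.update m (.B j) false) (.inr (.lower1 x)) none
  | lower1 (x) : ReaderStep m (.lower1 x) (Function.update m .flag1 false) (.inr (.lower2 x)) none
  | lower2 (x) :
      ReaderStep m (.lower2 x) (Function.update m .flag2 false) (.inl ()) (some (.value x))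

/-- The local state and the response after a step that continues with `o`. -/
def outcome {Idle Active R : Type} : Active ⊕ (Idle × R) → (Idle ⊕ Active) × Option R
  | .inl a => (.inr a, none)
  | .inr (s, r) => (.inl s, some r)

theorem readerStep_of_next [NeZero K] (m : Cell K → Bool) (a : ReaderPC K) :
    ReaderStep m a (a.prim.effect m) (outcome (a.next (a.prim.result m))).1
      (outcome (a.next (a.prim.result m))).2 := by
  cases a with
  | raise1 => exact .raise1
  | scanUp b j =>
    simp only [ReaderPC.prim, Prim.effect, Prim.result]
    cases h : m (.A j) with
    | true =>
      simp only [ReaderPC.next]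
      cases hd : down j with
      | some i => exact .scanUp_down b j i h (down_eq_some.1 hd)
      | none => exact .scanUp_found b j h (down_eq_none.1 hd)
    | false =>
      simp only [ReaderPC.next]
      cases hd : up j with
      | some i => exact .scanUp_next b j i h (up_eq_some.1 hd)
      | none =>
        cases b with
        | false => exact .scanUp_again j h (up_eq_none.1 hd)
        | true => exact .scanUp_fail j h (up_eq_none.1 hd)
  | scanDown x j =>
    simp only [ReaderPC.prim, Prim.effect, Prim.result, ReaderPC.next]
    cases hd : down j with
    | some i => exact .scanDown_next x j i (down_eq_some.1 hd)
    | none => exact .scanDown_last x j (down_eq_none.1 hd)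
  | readB x j =>
    simp only [ReaderPC.prim, Prim.effect, Prim.result, ReaderPC.next]
    cases hd : up j with
    | some i => exact .readB_next x j i (up_eq_some.1 hd)
    | none => exact .readB_last x j (up_eq_none.1 hd)
  | raise2 x => exact .raise2 x
  | clearB x j =>
    simp only [ReaderPC.prim, Prim.effect, ReaderPC.next]
    cases hd : up j with
    | some i => exact .clearB_next x j i (up_eq_some.1 hd)
    | none => exact .clearB_last x j (up_eq_none.1 hd)
  | lower1 x => exact .lower1 x
  | lower2 x => exact .lower2 x

/-- The step of the writer in the local state `s` in memory `m` leads to the memory and the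
local state that follow. -/
inductive WriterStep (m : Cell K → Bool) :
    WriterState K → (Cell K → Bool) → Fin K ⊕ WriterState K → Option (RegResp K) → Prop
  | checkB_next (l v e) (j i : Fin K) (hi : i.val = j.val + 1) :
      WriterStep m ⟨l, v, .checkB e j⟩ m (.inr ⟨l, v, .checkB (e && !m (.B j)) i⟩) none
  | checkB_empty (l v e) (j : Fin K) (hj : j.val + 1 = K) (h : (e && !m (.B j)) = true) :
      WriterStep m ⟨l, v, .checkB e j⟩ m (.inr ⟨l, v, .checkFlag1⟩) none
  | checkB_nonempty (l v e) (j : Fin K) (hj : j.val + 1 = K) (h : (e && !m (.B j)) = false) :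
      WriterStep m ⟨l, v, .checkB e j⟩ m (.inr ⟨l, v, .setA⟩) none
  | checkFlag1_help (l v) (h : m .flag1 = true) :
      WriterStep m ⟨l, v, .checkFlag1⟩ m (.inr ⟨l, v, .setB⟩) none
  | checkFlag1_skip (l v) (h : m .flag1 = false) :
      WriterStep m ⟨l, v, .checkFlag1⟩ m (.inr ⟨l, v, .setA⟩) none
  | setB (l v) : WriterStep m ⟨l, v, .setB⟩ (Function.update m (.B l) true)
      (.inr ⟨l, v, .recheckFlag2⟩) none
  | recheckFlag2 (l v) :
      WriterStep m ⟨l, v, .recheckFlag2⟩ m (.inr ⟨l, v, .recheckFlag1 (m .flag2)⟩) none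
  | recheckFlag1_undo (l v f) (h : (f || !m .flag1) = true) :
      WriterStep m ⟨l, v, .recheckFlag1 f⟩ m (.inr ⟨l, v, .unsetB⟩) none
  | recheckFlag1_keep (l v f) (h : (f || !m .flag1) = false) :
      WriterStep m ⟨l, v, .recheckFlag1 f⟩ m (.inr ⟨l, v, .setA⟩) none
  | unsetB (l v) : WriterStep m ⟨l, v, .unsetB⟩ (Function.update m (.B l) false)
      (.inr ⟨l, v, .setA⟩) none
  | setA_down (l v i : Fin K) (hi : i.val + 1 = v.val) :
      WriterStep m ⟨l, v, .setA⟩ (Function.update m (.A v) true) (.inr ⟨l, v, .clearDown i⟩) none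
  | setA_up (l v i : Fin K) (hv : v.val = 0) (hi : i.val = v.val + 1) :
      WriterStep m ⟨l, v, .setA⟩ (Function.update m (.A v) true) (.inr ⟨l, v, .clearUp i⟩) none
  | setA_return (l v : Fin K) (hv : v.val = 0) (hK : v.val + 1 = K) :
      WriterStep m ⟨l, v, .setA⟩ (Function.update m (.A v) true) (.inl v) (some .ack)
  | clearDown_down (l v j i : Fin K) (hi : i.val + 1 = j.val) :
      WriterStep m ⟨l, v, .clearDown j⟩ (Function.update m (.A j) false)
        (.inr ⟨l, v, .clearDown i⟩) none
  | clearDown_up (l v j i : Fin K) (hj : j.val = 0) (hi : i.val = v.val + 1) :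
      WriterStep m ⟨l, v, .clearDown j⟩ (Function.update m (.A j) false)
        (.inr ⟨l, v, .clearUp i⟩) none
  | clearDown_return (l v j : Fin K) (hj : j.val = 0) (hK : v.val + 1 = K) :
      WriterStep m ⟨l, v, .clearDown j⟩ (Function.update m (.A j) false) (.inl v) (some .ack)
  | clearUp_up (l v j i : Fin K) (hi : i.val = j.val + 1) :
      WriterStep m ⟨l, v, .clearUp j⟩ (Function.update m (.A j) false) (.inr ⟨l, v, .clearUp i⟩) none
  | clearUp_return (l v j : Fin K) (hj : j.val + 1 = K) :
      WriterStep m ⟨l, v, .clearUp j⟩ (Function.update m (.A j) false) (.inl v) (some .ack)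

theorem writerStep_of_next (m : Cell K → Bool) (s : WriterState K) :
    WriterStep m s (s.prim.effect m) (outcome (s.next (s.prim.result m))).1
      (outcome (s.next (s.prim.result m))).2 := by
  obtain ⟨l, v, pc⟩ := s
  cases pc with
  | checkB e j =>
    change WriterStep m _ m (outcome (WriterState.next ⟨l, v, .checkB e j⟩ (m (.B j)))).1
      (outcome (WriterState.next ⟨l, v, .checkB e j⟩ (m (.B j)))).2
    simp only [WriterState.next, WriterState.goto]
    cases hd : up j with
    | some i => exact .checkB_next l v e j i (up_eq_some.1 hd)
    | none =>
      dsimp only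
      by_cases h : (e && !m (.B j)) = true
      · rw [if_pos h]
        exact .checkB_empty l v e j (up_eq_none.1 hd) h
      · rw [if_neg h]
        exact .checkB_nonempty l v e j (up_eq_none.1 hd) (Bool.eq_false_of_not_eq_true h)
  | checkFlag1 =>
    change WriterStep m _ m (outcome (WriterState.next ⟨l, v, .checkFlag1⟩ (m .flag1))).1
      (outcome (WriterState.next ⟨l, v, .checkFlag1⟩ (m .flag1))).2
    simp only [WriterState.next, WriterState.goto]
    by_cases h : m .flag1 = true
    · rw [if_pos h]
      exact .checkFlag1_help l v h
    · rw [if_neg h]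
      exact .checkFlag1_skip l v (Bool.eq_false_of_not_eq_true h)
  | setB => exact .setB l v
  | recheckFlag2 => exact .recheckFlag2 l v
  | recheckFlag1 f =>
    change WriterStep m _ m (outcome (WriterState.next ⟨l, v, .recheckFlag1 f⟩ (m .flag1))).1
      (outcome (WriterState.next ⟨l, v, .recheckFlag1 f⟩ (m .flag1))).2
    simp only [WriterState.next, WriterState.goto]
    by_cases h : (f || !m .flag1) = true
    · rw [if_pos h]
      exact .recheckFlag1_undo l v f h
    · rw [if_neg h]
      exact .recheckFlag1_keep l v f (Bool.eq_false_of_not_eq_true h)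
  | unsetB => exact .unsetB l v
  | setA =>
    simp only [WriterState.prim, Prim.effect, WriterState.next, WriterState.goto,
      WriterState.gotoDown, WriterState.gotoUp]
    cases hd : down v with
    | some i => exact .setA_down l v i (down_eq_some.1 hd)
    | none =>
      cases hu : up v with
      | some i => exact .setA_up l v i (down_eq_none.1 hd) (up_eq_some.1 hu)
      | none => exact .setA_return l v (down_eq_none.1 hd) (up_eq_none.1 hu)
  | clearDown j =>
    simp only [WriterState.prim, Prim.effect, WriterState.next, WriterState.goto,
      WriterState.gotoDown, WriterState.gotoUp]
    cases hd : down j with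
    | some i => exact .clearDown_down l v j i (down_eq_some.1 hd)
    | none =>
      cases hu : up v with
      | some i => exact .clearDown_up l v j i (down_eq_none.1 hd) (up_eq_some.1 hu)
      | none => exact .clearDown_return l v j (down_eq_none.1 hd) (up_eq_none.1 hu)
  | clearUp j =>
    simp only [WriterState.prim, Prim.effect, WriterState.next, WriterState.goto,
      WriterState.gotoUp]
    cases hu : up j with
    | some i => exact .clearUp_up l v j i (up_eq_some.1 hu)
    | none => exact .clearUp_return l v j (up_eq_none.1 hu)

theorem ReaderStep.rank_lt [NeZero K] {m m' : Cell K → Bool} {a a' : ReaderPC K}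
    {r : Option (RegResp K)} (h : ReaderStep m a m' (.inr a') r) : a'.rank < a.rank := by
  cases h <;> simp only [ReaderPC.rank, Fin.val_zero, Bool.false_eq_true, if_true, if_false] <;>
    (try split_ifs) <;> omega

theorem WriterStep.rank_lt {m m' : Cell K → Bool} {s s' : WriterState K}
    {r : Option (RegResp K)} (h : WriterStep m s m' (.inr s') r) : s'.rank < s.rank := by
  cases h <;> simp only [WriterState.rank] <;> omega

theorem waitFree_algorithm (K : ℕ) [NeZero K] (v₀ : Fin K) : WaitFree (algorithm K v₀) := by
  refine waitFree_of_rank _ (fun p => match p with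
    | .reader => ReaderPC.rank
    | .writer => WriterState.rank) ?_
  intro p a m a' h
  cases p with
  | reader =>
    have hs := readerStep_of_next m (show ReaderPC K from a)
    change ReaderPC.next a ((ReaderPC.prim a).result m) = .inl a' at h
    rw [h] at hs
    exact hs.rank_lt
  | writer =>
    have hs := writerStep_of_next m (show WriterState K from a)
    change WriterState.next a ((WriterState.prim a).result m) = .inl a' at h
    rw [h] at hs
    exact hs.rank_lt

/-! ## Executions of the algorithm -/

section Executions

variable [NeZero K] {v₀ : Fin K}

/-- The local state of the reader in the `t`-th configuration. -/
def rd (α : Execution (algorithm K v₀)) (t : ℕ) : Unit ⊕ ReaderPC K := (α.cfg t).loc .reader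

/-- The local state of the writer in the `t`-th configuration. -/
def wr (α : Execution (algorithm K v₀)) (t : ℕ) : Fin K ⊕ WriterState K := (α.cfg t).loc .writer

/-- The effect of an action, or of no action, on the memory and the local states of the reader
and of the writer. -/
inductive Trans : Option (Action Proc (RegOp K)) → Option (RegResp K) →
    (Cell K → Bool) → Unit ⊕ ReaderPC K → Fin K ⊕ WriterState K →
    (Cell K → Bool) → Unit ⊕ ReaderPC K → Fin K ⊕ WriterState K → Prop
  | terminated (m r w) : Trans none none m r w m r w
  | invokeRead (m w) : Trans (some (.invoke .reader .read)) none m (.inl ()) w m (.inr .raise1) w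
  | invokeWrite (m r l v) : Trans (some (.invoke .writer (.write v))) none m r (.inl l)
      m r (.inr ⟨l, v, .checkB true 0⟩)
  | stepReader {m a m' r' o} (w) (h : ReaderStep m a m' r' o) :
      Trans (some (.step .reader)) o m (.inr a) w m' r' w
  | stepWriter {m s m' w' o} (r) (h : WriterStep m s m' w' o) :
      Trans (some (.step .writer)) o m r (.inr s) m' r w'

theorem trans_of_execution (α : Execution (algorithm K v₀)) (t : ℕ) :
    Trans (α.actions.get? t) (α.resp t) (α.cfg t).mem (rd α t) (wr α t)
      (α.cfg (t + 1)).mem (rd α (t + 1)) (wr α (t + 1)) := by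
  unfold rd wr
  cases hact : α.actions.get? t with
  | none =>
    rw [(Execution.cfg_stop α t hact).1, (Execution.cfg_stop α t hact).2]
    exact .terminated _ _ _
  | some act =>
    have hs := α.cfg_succ t act hact
    generalize α.cfg (t + 1) = C' at hs ⊢
    generalize α.resp t = o' at hs ⊢
    generalize α.cfg t = C at hs ⊢
    cases act with
    | invoke p o =>
      simp only [Config.perform] at hs
      split at hs
      · rename_i s hl
        simp only [Option.map_eq_some_iff, Prod.mk.injEq] at hs
        obtain ⟨a, ha, rfl, rfl⟩ := hs
        cases p with
        | reader =>
          cases o with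
          | read =>
            simp only [Function.update_self]
            rw [Function.update_of_ne (by decide), hl]
            cases ha
            exact .invokeRead _ _
          | write v => cases ha
        | writer =>
          cases o with
          | read => cases ha
          | write v =>
            simp only [Function.update_self]
            rw [Function.update_of_ne (by decide), hl]
            cases ha
            exact .invokeWrite _ _ _ _
      · cases hs
    | step p =>
      simp only [Config.perform] at hs
      split at hs
      · cases hs
      · rename_i a hl
        cases p with
        | reader =>
          have h := readerStep_of_next C.mem (show ReaderPC K from a)
          rw [hl]
          cases hn : (algorithm K v₀).next .reader a
              (((algorithm K v₀).prim .reader a).result C.mem) with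
          | inl a' =>
            rw [hn] at hs
            change ReaderPC.next a ((ReaderPC.prim a).result C.mem) = _ at hn
            rw [hn] at h
            simp only [Option.some.injEq, Prod.mk.injEq] at hs
            obtain ⟨rfl, rfl⟩ := hs
            simp only [Function.update_self]
            rw [Function.update_of_ne (by decide)]
            exact .stepReader _ h
          | inr sr =>
            rw [hn] at hs
            change ReaderPC.next a ((ReaderPC.prim a).result C.mem) = _ at hn
            rw [hn] at h
            simp only [Option.some.injEq, Prod.mk.injEq] at hs
            obtain ⟨rfl, rfl⟩ := hs
            simp only [Function.update_self]
            rw [Function.update_of_ne (by decide)]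
            exact .stepReader _ h
        | writer =>
          have h := writerStep_of_next C.mem (show WriterState K from a)
          rw [hl]
          cases hn : (algorithm K v₀).next .writer a
              (((algorithm K v₀).prim .writer a).result C.mem) with
          | inl a' =>
            rw [hn] at hs
            change WriterState.next a ((WriterState.prim a).result C.mem) = _ at hn
            rw [hn] at h
            simp only [Option.some.injEq, Prod.mk.injEq] at hs
            obtain ⟨rfl, rfl⟩ := hs
            simp only [Function.update_self]
            rw [Function.update_of_ne (by decide)]
            exact .stepWriter _ h
          | inr sr =>
            rw [hn] at hs
            change WriterState.next a ((WriterState.prim a).result C.mem) = _ at hn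
            rw [hn] at h
            simp only [Option.some.injEq, Prod.mk.injEq] at hs
            obtain ⟨rfl, rfl⟩ := hs
            simp only [Function.update_self]
            rw [Function.update_of_ne (by decide)]
            exact .stepWriter _ h

end Executions

end HIReg

namespace HIReg

variable {K : ℕ}

/-! ## The abstract value -/

/-- The pending Write has taken effect: its value is the least index of a cell of `A` that
holds 1. -/
def WriterState.committed (s : WriterState K) : Bool :=
  match s.pc with
  | .clearDown j => decide (¬ (s.last < s.v ∧ s.last ≤ j))
  | .clearUp _ => true
  | _ => false

/-- The value of the register, determined by the local state of the writer. -/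
def currentValue : Fin K ⊕ WriterState K → Fin K
  | .inl l => l
  | .inr s => if s.committed then s.v else s.last

/-- A Write of `v` is pending and has not taken effect. -/
def Uncommitted (v : Fin K) : Fin K ⊕ WriterState K → Prop
  | .inl _ => False
  | .inr s => s.v = v ∧ s.committed = false

/-- The value changes only at the commit: at `A[v] ← 1` when `v ≤ last`, at the clearing of
`A[last]` when `last < v`. -/
theorem WriterStep.uncommitted_or {m m' : Cell K → Bool} {s : WriterState K}
    {w' : Fin K ⊕ WriterState K} {o : Option (RegResp K)} (h : WriterStep m s m' w' o)
    (hs : s.committed = false) :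
    (Uncommitted s.v w' ∧ currentValue w' = currentValue (.inr s)) ∨
      ((∀ v, ¬ Uncommitted v w') ∧ currentValue w' = s.v) := by
  cases h <;> simp_all [Uncommitted, currentValue, WriterState.committed] <;> grind

theorem WriterStep.not_uncommitted {m m' : Cell K → Bool} {s : WriterState K}
    {w' : Fin K ⊕ WriterState K} {o : Option (RegResp K)} (h : WriterStep m s m' w' o)
    (hs : s.committed = true) :
    (∀ v, ¬ Uncommitted v w') ∧ currentValue w' = currentValue (.inr s) := by
  cases h <;> simp_all [Uncommitted, currentValue, WriterState.committed]
  grind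

/-! ## The invariant -/

/-- The bounds on the loop variables of the writer. -/
def WriterBounds : Fin K ⊕ WriterState K → Prop
  | .inl _ => True
  | .inr s =>
    match s.pc with
    | .clearDown j => j < s.v
    | .clearUp j => s.v < j
    | _ => True

/-- The cells of `A` that hold 1. -/
def InA (i : Fin K) : Fin K ⊕ WriterState K → Prop
  | .inl l => i = l
  | .inr s =>
    match s.pc with
    | .clearDown j => i = s.v ∨ (i = s.last ∧ ¬ (j < s.last ∧ s.last < s.v))
    | .clearUp j => i = s.v ∨ (i = s.last ∧ j ≤ s.last)
    | _ => i = s.last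

/-- The index of the cell of `A` that was set last. -/
def target : Fin K ⊕ WriterState K → Fin K
  | .inl l => l
  | .inr s =>
    match s.pc with
    | .clearDown _ => s.v
    | .clearUp _ => s.v
    | _ => s.last

/-- A control point names the primitive still to come, so `flag[1]` is still 0 at `raise1` and
already 0 at `lower2`, where `flag[2]` is still 1. -/
def ReaderFlag1 : Unit ⊕ ReaderPC K → Bool
  | .inl _ => false
  | .inr .raise1 => false
  | .inr (.lower2 _) => false
  | .inr _ => true

def ReaderFlag2 : Unit ⊕ ReaderPC K → Bool
  | .inr (.clearB _ _) => true
  | .inr (.lower1 _) => true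
  | .inr (.lower2 _) => true
  | _ => false

/-- The pending Read has raised `flag[1]` and will still clear `B[i]`. -/
def WillClear (i : Fin K) : Unit ⊕ ReaderPC K → Prop
  | .inr (.scanUp _ _) => True
  | .inr (.scanDown _ _) => True
  | .inr (.readB _ _) => True
  | .inr (.raise2 _) => True
  | .inr (.clearB _ j) => j ≤ i
  | _ => False

/-- The writer has set `B[i]` and will reset it unless the reader is going to clear it. -/
def MayUnset (i : Fin K) (r : Unit ⊕ ReaderPC K) : Fin K ⊕ WriterState K → Prop
  | .inl _ => False
  | .inr s => s.last = i ∧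
    match s.pc with
    | .recheckFlag2 => True
    | .recheckFlag1 f => f = true ∨ r = .inl () ∨ r = .inr .raise1
    | .unsetB => True
    | _ => False

/-- If the writer proceeds to its next `A[v] ← 1` while the reader is scanning, it leaves some
cell of `B` set. -/
def Helping (m : Cell K → Bool) : Fin K ⊕ WriterState K → Prop
  | .inl _ => True
  | .inr s =>
    match s.pc with
    | .checkB e _ => e = false → ∃ i, m (.B i) = true
    | .recheckFlag2 => m (.B s.last) = true
    | .recheckFlag1 f => f = false ∧ m (.B s.last) = true
    | .unsetB => False
    | .setA => ∃ i, m (.B i) = true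
    | _ => True

/-- A pending Write of a value below `p`, smaller than the old value, took effect during the
pending Read, so that the old value is among the values `S` seen by this Read. -/
def LoweredSeen (S : Fin K → Prop) (p : Fin K) : Fin K ⊕ WriterState K → Prop
  | .inl _ => True
  | .inr s => s.committed = true → s.v < s.last → s.v < p → S s.last

/-- A Write of `x` is pending that takes effect when it clears a cell of `A` with index at
most `j`. -/
def Rising (x j : Fin K) : Fin K ⊕ WriterState K → Prop
  | .inl _ => False
  | .inr s =>
    match s.pc with
    | .clearDown j' => s.v = x ∧ s.last < s.v ∧ s.last ≤ j' ∧ s.last ≤ j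
    | _ => False

/-- The part of the invariant about the local state of the reader; `S` are the values of the
register seen during the pending Read. -/
def ReaderInv (m : Cell K → Bool) (w : Fin K ⊕ WriterState K) (S : Fin K → Prop) :
    ReaderPC K → Prop
  | .raise1 => True
  | .scanUp b j => LoweredSeen S j w ∧ (∀ i, m (.B i) = true → S i) ∧
      if b then Helping m w ∧ (j ≤ target w ∨ ∃ i, m (.B i) = true)
      else j ≤ target w ∨ Helping m w
  | .scanDown x j => j < x ∧ LoweredSeen S j w ∧ (S x ∨ Rising x j w)
  | .readB x j => Helping m w ∧ (∀ i, m (.B i) = true → S i) ∧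
      (x.isSome ∨ ∃ i, j ≤ i ∧ m (.B i) = true) ∧ ∀ y, x = some y → S y
  | .raise2 x => ∃ y, x = some y ∧ S y
  | .clearB x _ => ∃ y, x = some y ∧ S y
  | .lower1 x => ∃ y, x = some y ∧ S y
  | .lower2 x => ∃ y, x = some y ∧ S y

/-- The clause `memB` makes `B` vanish at quiescence; the clause `reader` makes the returned value a
seen one. -/
structure Inv (m : Cell K → Bool) (r : Unit ⊕ ReaderPC K) (w : Fin K ⊕ WriterState K)
    (S : Fin K → Prop) : Prop where
  bounds : WriterBounds w
  memA : ∀ i, m (.A i) = true ↔ InA i w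
  flag1 : m .flag1 = ReaderFlag1 r
  flag2 : m .flag2 = ReaderFlag2 r
  memB : ∀ i, m (.B i) = true → WillClear i r ∨ MayUnset i r w
  reader : ∀ a, r = .inr a → ReaderInv m w S a

/-! ### Writer steps -/

section WriterStep

variable {m m' : Cell K → Bool} {s : WriterState K} {w' : Fin K ⊕ WriterState K}
  {o : Option (RegResp K)} {r : Unit ⊕ ReaderPC K} {S S' : Fin K → Prop}

theorem WriterStep.bounds (h : WriterStep m s m' w' o) (hb : WriterBounds (.inr s)) :
    WriterBounds w' := by
  cases h <;> simp_all [WriterBounds] <;> grind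

/-- The loop bounds ensure that the clearing loops never erase `A[v]`. -/
theorem WriterStep.memA (h : WriterStep m s m' w' o) (hb : WriterBounds (.inr s))
    (hA : ∀ i, m (.A i) = true ↔ InA i (.inr s)) (i : Fin K) : m' (.A i) = true ↔ InA i w' := by
  have hi := hA i
  cases h <;> simp_all [WriterBounds, InA, Function.update_apply] <;> grind

theorem WriterStep.flags (h : WriterStep m s m' w' o) :
    m' .flag1 = m .flag1 ∧ m' .flag2 = m .flag2 := by
  cases h <;> simp

/-- If the reader has already passed `B[i]`, the writer must notice. From then until the Read
returns `flag[2]` is 1, and afterwards `flag[1]` is 0 until the next Read raises it and becomes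
responsible for clearing `B[i]`. Since the writer reads `flag[2]` before `flag[1]`, it cannot miss
both signs unless such a new Read has begun. -/
theorem WriterStep.memB (h : WriterStep m s m' w' o) (h1 : m .flag1 = ReaderFlag1 r)
    (h2 : m .flag2 = ReaderFlag2 r)
    (hB : ∀ i, m (.B i) = true → WillClear i r ∨ MayUnset i r (.inr s)) (i : Fin K)
    (hi : m' (.B i) = true) : WillClear i r ∨ MayUnset i r w' := by
  have hBi := hB i
  rcases r with _ | r
  · cases h <;>
      simp_all [WillClear, MayUnset, ReaderFlag1, Function.update_apply]
  · cases r <;> cases h <;>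
      simp_all [WillClear, MayUnset, ReaderFlag1, ReaderFlag2, Function.update_apply] <;> grind

/-- The hypotheses inside `LoweredSeen` become true only at `A[v] ← 1` with `v < last`, and just
before that step `last` is the current value. -/
theorem WriterStep.loweredSeen (h : WriterStep m s m' w' o) (hS : ∀ x, S x → S' x)
    (hcur : S (currentValue (.inr s))) {p : Fin K} (hL : LoweredSeen S p (.inr s)) :
    LoweredSeen S' p w' := by
  cases h <;> simp_all [LoweredSeen, currentValue, WriterState.committed] <;> grind

/-- The writer sets only `B[last]`, and does so before its Write takes effect, when `last` is
current. -/
theorem WriterStep.seenB (h : WriterStep m s m' w' o) (hS : ∀ x, S x → S' x)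
    (hcur : S (currentValue (.inr s))) (hB : ∀ i, m (.B i) = true → S i) (i : Fin K)
    (hi : m' (.B i) = true) : S' i := by
  cases h <;> simp_all [currentValue, WriterState.committed, Function.update_apply]
  grind

/-- With `flag[1] = 1` and `flag[2] = 0`, a writer that finds `B` empty must set `B[last]` and has
no reason to undo it. -/
theorem WriterStep.helping (h : WriterStep m s m' w' o) (h1 : m .flag1 = true)
    (h2 : m .flag2 = false) (hH : Helping m (.inr s)) : Helping m' w' := by
  cases h <;> simp_all [Helping] <;> grind

theorem WriterStep.memB_mono (h : WriterStep m s m' w' o) (hH : Helping m (.inr s)) {i : Fin K}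
    (hi : m (.B i) = true) : m' (.B i) = true := by
  cases h <;> simp_all [Helping, Function.update_apply]

/-- Only `A[v] ← 1` moves the target. After it `Helping` asks for nothing, and before it `Helping`
says that `B` is not empty. -/
theorem WriterStep.target_eq_or (h : WriterStep m s m' w' o) :
    target w' = target (.inr s) ∨
      Helping m' w' ∧ (Helping m (.inr s) → ∃ i, m' (.B i) = true) := by
  cases h <;> simp_all [Helping, target]

/-- The downward loop of the writer keeps `Rising` until it clears `A[last]`; at that step `x`
becomes the current value. -/
theorem WriterStep.rising (h : WriterStep m s m' w' o) (hcur : S' (currentValue w'))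
    {x j : Fin K} (hR : Rising x j (.inr s)) : S' x ∨ Rising x j w' := by
  cases h <;> simp_all [Rising, currentValue, WriterState.committed]
  grind

theorem WriterStep.readerInv (h : WriterStep m s m' w' o) {a : ReaderPC K}
    (h1 : m .flag1 = ReaderFlag1 (.inr a)) (h2 : m .flag2 = ReaderFlag2 (.inr a))
    (hS : ∀ x, S x → S' x) (hcur : S (currentValue (.inr s))) (hcur' : S' (currentValue w'))
    (hR : ReaderInv m (.inr s) S a) : ReaderInv m' w' S' a := by
  cases a with
  | raise1 => trivial
  | scanUp b j =>
    obtain ⟨hL, hB, hT⟩ := hR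
    refine ⟨h.loweredSeen hS hcur hL, h.seenB hS hcur hB, ?_⟩
    have ht := h.target_eq_or
    cases b with
    | false =>
      rcases hT with hT | hT
      · rcases ht with ht | ht
        · exact .inl (ht ▸ hT)
        · exact .inr ht.1
      · exact .inr (h.helping h1 h2 hT)
    | true =>
      refine ⟨h.helping h1 h2 hT.1, ?_⟩
      rcases hT.2 with hT' | ⟨i, hi⟩
      · rcases ht with ht | ht
        · exact .inl (ht ▸ hT')
        · exact .inr (ht.2 hT.1)
      · exact .inr ⟨i, h.memB_mono hT.1 hi⟩
  | scanDown x j =>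
    obtain ⟨hj, hL, hx⟩ := hR
    refine ⟨hj, h.loweredSeen hS hcur hL, ?_⟩
    rcases hx with hx | hx
    · exact .inl (hS x hx)
    · exact h.rising hcur' hx
  | readB x j =>
    obtain ⟨hH, hB, hx, hy⟩ := hR
    refine ⟨h.helping h1 h2 hH, h.seenB hS hcur hB, ?_, fun y h' => hS y (hy y h')⟩
    rcases hx with hx | ⟨i, hi, hi'⟩
    · exact .inl hx
    · exact .inr ⟨i, hi, h.memB_mono hH hi'⟩
  | raise2 x => exact hR.imp fun y h' => ⟨h'.1, hS y h'.2⟩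
  | clearB x _ => exact hR.imp fun y h' => ⟨h'.1, hS y h'.2⟩
  | lower1 x => exact hR.imp fun y h' => ⟨h'.1, hS y h'.2⟩
  | lower2 x => exact hR.imp fun y h' => ⟨h'.1, hS y h'.2⟩

end WriterStep

/-! ### Reader steps -/

section ReaderStep

variable {m m' : Cell K → Bool} {a : ReaderPC K} {r' : Unit ⊕ ReaderPC K}
  {o : Option (RegResp K)} {w : Fin K ⊕ WriterState K} {S S' : Fin K → Prop}

theorem InA.target (w : Fin K ⊕ WriterState K) : InA (target w) w := by
  rcases w with _ | ⟨l, v, pc⟩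
  · rfl
  · cases pc <;> simp [InA, HIReg.target]

/-- A scan that reads `A[j] = 1` sees the value `j`, unless it is that of a pending Write which
takes effect before the downward scan is over. -/
theorem InA.seen_or_rising {j : Fin K} (hA : InA j w) (hb : WriterBounds w)
    (hL : LoweredSeen S j w) (hcur : S (currentValue w)) :
    S j ∨ (j.val ≠ 0 ∧ ∀ i : Fin K, i.val + 1 = j.val → Rising j i w) := by
  rcases w with _ | ⟨l, v, pc⟩
  · simp_all [InA, currentValue]
  · cases pc <;>
      simp_all [InA, currentValue, WriterBounds, LoweredSeen, WriterState.committed, Rising] <;>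
      grind

theorem LoweredSeen.of_le {p q : Fin K} (hL : LoweredSeen S p w) (hq : q ≤ p)
    (hS : ∀ x, S x → S' x) : LoweredSeen S' q w := by
  rcases w with _ | s
  · trivial
  · exact fun h1 h2 h3 => hS _ (hL h1 h2 (lt_of_lt_of_le h3 hq))

/-- If a Write of `p` had lowered the value, `A[p]` would hold 1; so passing a 0 at `p` adds no new
case. -/
theorem LoweredSeen.succ {p q : Fin K} (hL : LoweredSeen S p w) (hq : q.val = p.val + 1)
    (hp : ¬ InA p w) (hS : ∀ x, S x → S' x) : LoweredSeen S' q w := by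
  rcases w with _ | ⟨l, v, pc⟩
  · trivial
  · cases pc <;> simp_all [LoweredSeen, WriterState.committed, InA] <;> grind

/-- In the `Rising` situation `A[last]` is still 1, so a 0 read at `j ≥ last` forces `last < j`: the
scan cannot end before it meets `last`. -/
theorem Rising.of_not_inA {x j : Fin K} (hR : Rising x j w) (hj : ¬ InA j w) :
    j.val ≠ 0 ∧ ∀ i : Fin K, i.val + 1 = j.val → Rising x i w := by
  rcases w with _ | ⟨l, v, pc⟩
  · cases hR
  · cases pc <;> simp only [Rising, InA] at *
    grind

variable [NeZero K]

theorem ReaderStep.memA (h : ReaderStep m a m' r' o) (i : Fin K) : m' (.A i) = m (.A i) := by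
  cases h <;> simp

theorem ReaderStep.flags (h : ReaderStep m a m' r' o) (h1 : m .flag1 = ReaderFlag1 (.inr a))
    (h2 : m .flag2 = ReaderFlag2 (.inr a)) :
    m' .flag1 = ReaderFlag1 r' ∧ m' .flag2 = ReaderFlag2 r' := by
  cases h <;> simp_all [ReaderFlag1, ReaderFlag2]

/-- The reader gives up responsibility for a cell only by clearing it. Raising `flag[1]` may cancel
the writer's duty to reset a cell, but makes the reader responsible for all cells. -/
theorem ReaderStep.memB (h : ReaderStep m a m' r' o)
    (hB : ∀ i, m (.B i) = true → WillClear i (.inr a) ∨ MayUnset i (.inr a) w) (i : Fin K)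
    (hi : m' (.B i) = true) : WillClear i r' ∨ MayUnset i r' w := by
  have hBi := hB i
  rcases w with _ | ⟨l, v, pc⟩
  · cases h <;> simp_all [WillClear, MayUnset, Function.update_apply] <;> grind
  · cases pc <;> cases h <;> simp_all [WillClear, MayUnset, Function.update_apply] <;> grind

theorem ReaderStep.readerInv {a' : ReaderPC K} (h : ReaderStep m a m' (.inr a') o)
    (hb : WriterBounds w) (hA : ∀ i, m (.A i) = true ↔ InA i w)
    (hB : ∀ i, m (.B i) = true → WillClear i (.inr a) ∨ MayUnset i (.inr a) w)
    (hS : ∀ x, S x → S' x) (hcur : S (currentValue w))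
    (hR : ReaderInv m w S a) : ReaderInv m' w S' a' := by
  have hT : m (.A (target w)) = true := (hA _).2 (InA.target w)
  cases h with
  | raise1 =>
    -- No index lies below 0, so `LoweredSeen` is vacuous. A cell of `B` set at this moment can only
    -- be one that the writer may unset, hence `B[last]` with `last` current.
    refine ⟨?_, ?_, .inl (by simp)⟩
    · rcases w with _ | s
      · trivial
      · intro _ _ h3
        simp at h3
    · intro i hi
      have := hB i (by simpa using hi)
      apply hS
      rcases w with _ | ⟨l, v, pc⟩
      · simp_all [WillClear, MayUnset]
      · cases pc <;> simp_all [WillClear, MayUnset, currentValue, WriterState.committed]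
  | scanUp_down b j i hj hi =>
    obtain ⟨hL, -, -⟩ := hR
    refine ⟨by simp only [Fin.lt_def]; omega,
      hL.of_le (by simp only [Fin.le_def]; omega) hS, ?_⟩
    exact (((hA j).1 hj).seen_or_rising hb hL hcur).imp (hS j) (fun h' => h'.2 i hi)
  | scanUp_found b j hj hj0 =>
    obtain ⟨hL, -, -⟩ := hR
    refine ⟨j, rfl, hS _ ?_⟩
    rcases ((hA j).1 hj).seen_or_rising hb hL hcur with h' | h'
    · exact h'
    · exact absurd hj0 h'.1
  | scanUp_next b j i hj hi => 
    obtain ⟨hL, hB', hT'⟩ := hR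
    -- The target cell always holds 1, so a cell just read as 0 is not the target.
    have hne : target w ≠ j := by rintro rfl; rw [hj] at hT; cases hT
    refine ⟨hL.succ hi (by rw [← hA, hj]; simp) hS, fun i hi => hS i (hB' i hi), ?_⟩
    have hle : j ≤ target w → i ≤ target w := by
      intro h'
      have := lt_of_le_of_ne h' hne.symm
      simp only [Fin.lt_def, Fin.le_def] at *
      omega
    cases b with
    | false => exact hT'.imp_left hle
    | true => exact ⟨hT'.1, hT'.2.imp_left hle⟩
  | scanUp_again j hj hjK =>
    obtain ⟨hL, hB', hT'⟩ := hR
    have hne : target w ≠ j := by rintro rfl; rw [hj] at hT; cases hT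
    refine ⟨?_, fun i hi => hS i (hB' i hi), ?_, .inl (by simp)⟩
    · rcases w with _ | s
      · trivial
      · intro _ _ h3
        simp at h3
    -- A target at or above the last index would have been found, so the failed first scan yields
    -- `Helping`.
    · rcases hT' with h' | h'
      · have := lt_of_le_of_ne h' hne.symm
        have := (target w).isLt
        simp only [Fin.lt_def] at *
        omega
      · exact h'
  | scanUp_fail j hj hjK =>
    obtain ⟨hL, hB', hH, hT'⟩ := hR
    have hne : target w ≠ j := by rintro rfl; rw [hj] at hT; cases hT
    refine ⟨hH, fun i hi => hS i (hB' i hi), .inr ?_, by simp⟩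
    -- As in the first scan, the target cannot have been missed; what remains is a set cell of `B`.
    rcases hT' with h' | ⟨i, hi⟩
    · have := lt_of_le_of_ne h' hne.symm
      have := (target w).isLt
      simp only [Fin.lt_def] at *
      omega
    · exact ⟨i, by simp, hi⟩
  | scanDown_next x j i hi =>
    obtain ⟨hx, hL, hx'⟩ := hR
    refine ⟨?_, hL.of_le (by simp only [Fin.le_def]; omega) hS, ?_⟩
    · split_ifs <;> simp only [Fin.lt_def] at * <;> omega
    · split_ifs with hj
      · exact (((hA j).1 hj).seen_or_rising hb hL hcur).imp (hS j) (fun h' => h'.2 i hi)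
      · refine hx'.imp (hS x) fun h' => ?_
        rw [hA] at hj
        exact (h'.of_not_inA hj).2 i hi
  | scanDown_last x j hj0 =>
    obtain ⟨hx, hL, hx'⟩ := hR
    refine ⟨_, rfl, hS _ ?_⟩
    split_ifs with hj
    · rcases ((hA j).1 hj).seen_or_rising hb hL hcur with h' | h'
      · exact h'
      · exact absurd hj0 h'.1
    · rcases hx' with h' | h'
      · exact h'
      · rw [hA] at hj
        exact absurd hj0 (h'.of_not_inA hj).1
  | readB_next x j i hi =>
    obtain ⟨hH, hB', hx, hy⟩ := hR
    refine ⟨hH, fun i hi => hS i (hB' i hi), ?_, ?_⟩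
    · split_ifs with hj
      · simp
      · refine hx.imp_right ?_
        rintro ⟨k, hk, hk'⟩
        refine ⟨k, ?_, hk'⟩
        have : k ≠ j := by rintro rfl; exact hj hk'
        have := lt_of_le_of_ne hk this.symm
        simp only [Fin.lt_def, Fin.le_def] at *
        omega
    · intro y
      split_ifs with hj
      · rintro ⟨⟩
        exact hS _ (hB' _ hj)
      · exact fun h' => hS _ (hy y h')
  | readB_last x j hjK =>
    obtain ⟨hH, hB', hx, hy⟩ := hR
    change ∃ y, _ ∧ _
    split_ifs with hj
    · exact ⟨j, rfl, hS _ (hB' _ hj)⟩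
    · rcases hx with hx | ⟨k, hk, hk'⟩
      · obtain ⟨y, rfl⟩ := Option.isSome_iff_exists.1 hx
        exact ⟨y, rfl, hS _ (hy y rfl)⟩
      · have : k = j := by
          have := k.isLt
          simp only [Fin.le_def, Fin.ext_iff] at *
          omega
        exact absurd (this ▸ hk') hj
  | raise2 x => exact hR.imp fun y h' => ⟨h'.1, hS y h'.2⟩
  | clearB_next x => exact hR.imp fun y h' => ⟨h'.1, hS y h'.2⟩
  | clearB_last x => exact hR.imp fun y h' => ⟨h'.1, hS y h'.2⟩
  | lower1 x => exact hR.imp fun y h' => ⟨h'.1, hS y h'.2⟩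

end ReaderStep

end HIReg

namespace HIReg

variable {K : ℕ}

theorem Uncommitted.unique {v v' : Fin K} {w : Fin K ⊕ WriterState K} (h : Uncommitted v w)
    (h' : Uncommitted v' w) : v = v' := by
  rcases w with _ | s
  · cases h
  · exact h.1.symm.trans h'.1

/-! ## The invariant holds in executions -/

theorem ReaderInv.mono {m : Cell K → Bool} {w : Fin K ⊕ WriterState K} {S S' : Fin K → Prop}
    {a : ReaderPC K} (h : ReaderInv m w S a) (hS : ∀ x, S x → S' x) : ReaderInv m w S' a := by
  cases a with
  | raise1 => trivial
  | scanUp b j => exact ⟨h.1.of_le le_rfl hS, fun i hi => hS i (h.2.1 i hi), h.2.2⟩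
  | scanDown x j => exact ⟨h.1, h.2.1.of_le le_rfl hS, h.2.2.imp_left (hS x)⟩
  | readB x j =>
    exact ⟨h.1, fun i hi => hS i (h.2.1 i hi), h.2.2.1, fun y hy => hS y (h.2.2.2 y hy)⟩
  | raise2 x => exact h.imp fun y h' => ⟨h'.1, hS y h'.2⟩
  | clearB x _ => exact h.imp fun y h' => ⟨h'.1, hS y h'.2⟩
  | lower1 x => exact h.imp fun y h' => ⟨h'.1, hS y h'.2⟩
  | lower2 x => exact h.imp fun y h' => ⟨h'.1, hS y h'.2⟩

theorem ReaderInv.invokeWrite [NeZero K] {m : Cell K → Bool} {l v : Fin K} {S : Fin K → Prop}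
    {a : ReaderPC K} (h : ReaderInv m (.inl l) S a) :
    ReaderInv m (.inr ⟨l, v, .checkB true 0⟩) S a := by
  cases a <;>
    simp_all [ReaderInv, LoweredSeen, WriterState.committed, Helping, target, Rising]

/-- The conditions on `S'` are required only while a Read is pending afterwards, because the set of
seen values starts afresh with each Read. -/
theorem Inv.trans [NeZero K] {act : Option (Action Proc (RegOp K))} {o : Option (RegResp K)}
    {m m' : Cell K → Bool} {r r' : Unit ⊕ ReaderPC K} {w w' : Fin K ⊕ WriterState K}
    {S S' : Fin K → Prop} (h : Trans act o m r w m' r' w') (hI : Inv m r w S)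
    (hcur : ∀ a, r = .inr a → S (currentValue w))
    (hS : ∀ a, r' = .inr a → ∀ x, S x → S' x)
    (hcur' : ∀ a, r' = .inr a → S' (currentValue w')) : Inv m' r' w' S' := by
  cases h with
  | terminated => exact { hI with reader := fun a ha => (hI.reader a ha).mono (hS a ha) }
  | invokeRead =>
    refine ⟨hI.bounds, hI.memA, hI.flag1, hI.flag2, ?_, ?_⟩
    · intro i hi
      rcases hI.memB i hi with h | h
      · cases h
      · right
        rcases w with _ | ⟨l, v, pc⟩
        · cases h
        · cases pc <;> simp_all [MayUnset]
    · rintro a ⟨⟩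
      trivial
  | invokeWrite _ _ l v =>
    refine ⟨trivial, hI.memA, hI.flag1, hI.flag2, ?_, ?_⟩
    · intro i hi
      rcases hI.memB i hi with h | h
      · exact .inl h
      · cases h
    · intro a ha
      exact ((hI.reader a ha).mono (hS a ha)).invokeWrite
  | stepReader _ h =>
    have hf := h.flags hI.flag1 hI.flag2
    refine ⟨hI.bounds, fun i => by rw [h.memA, hI.memA], hf.1, hf.2, h.memB hI.memB, ?_⟩
    rintro a rfl
    exact h.readerInv hI.bounds hI.memA hI.memB (hS a rfl) (hcur _ rfl) (hI.reader _ rfl)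
  | stepWriter _ h =>
    refine ⟨h.bounds hI.bounds, h.memA hI.bounds hI.memA, h.flags.1.trans hI.flag1,
      h.flags.2.trans hI.flag2, h.memB hI.flag1 hI.flag2 hI.memB, ?_⟩
    rintro a rfl
    exact h.readerInv hI.flag1 hI.flag2 (hS a rfl) (hcur a rfl) (hcur' a rfl) (hI.reader a rfl)

variable [NeZero K] {v₀ : Fin K}

/-- The value of the register in the `t`-th configuration. -/
def valueAt (α : Execution (algorithm K v₀)) (t : ℕ) : Fin K := currentValue (wr α t)

/-- The register had the value `x` at some time since the invocation of the Read that is pending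
in the `t`-th configuration. -/
def Seen (α : Execution (algorithm K v₀)) (t : ℕ) (x : Fin K) : Prop :=
  ∃ s, s ≤ t ∧ valueAt α s = x ∧ ∀ u, s ≤ u → u ≤ t → ∃ a, rd α u = .inr a

theorem rd_zero (α : Execution (algorithm K v₀)) : rd α 0 = .inl () := by
  unfold rd
  rw [α.cfg_zero]
  rfl

theorem wr_zero (α : Execution (algorithm K v₀)) : wr α 0 = .inl v₀ := by
  unfold wr
  rw [α.cfg_zero]
  rfl

theorem inv_of_execution (α : Execution (algorithm K v₀)) (t : ℕ) :
    Inv (α.cfg t).mem (rd α t) (wr α t) (Seen α t) := by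
  induction t with
  | zero =>
    rw [rd_zero, wr_zero, α.cfg_zero]
    refine ⟨trivial, ?_, rfl, rfl, ?_, ?_⟩
    · intro i
      simp [Config.initial, algorithm, InA]
    · intro i hi
      simp [Config.initial, algorithm] at hi
    · rintro a ⟨⟩
  | succ t ih =>
    refine ih.trans (trans_of_execution α t) ?_ ?_ ?_
    · intro a ha
      refine ⟨t, le_rfl, rfl, fun u h1 h2 => ?_⟩
      rw [le_antisymm h2 h1]
      exact ⟨a, ha⟩
    · rintro a ha x ⟨s, hs, hx, hu⟩
      refine ⟨s, by omega, hx, fun u h1 h2 => ?_⟩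
      rcases Nat.le_succ_iff.1 h2 with h | rfl
      · exact hu u h1 h
      · exact ⟨a, ha⟩
    · intro a ha
      refine ⟨t + 1, le_rfl, rfl, fun u h1 h2 => ?_⟩
      rw [le_antisymm h2 h1]
      exact ⟨a, ha⟩

/-- In a quiescent configuration the memory is determined by the value of the register. -/
theorem mem_of_quiescent (α : Execution (algorithm K v₀)) (t : ℕ)
    (h : (α.cfg t).Quiescent) (c : Cell K) :
    (α.cfg t).mem c = decide (c = .A (valueAt α t)) := by
  have hI := inv_of_execution α t
  obtain ⟨⟨⟩, hr⟩ : ∃ u, rd α t = .inl u := Sum.isLeft_iff.1 (h .reader)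
  obtain ⟨l, hw⟩ : ∃ l, wr α t = .inl l := Sum.isLeft_iff.1 (h .writer)
  rw [valueAt, hw]
  rw [hr, hw] at hI
  cases c with
  | A i =>
    have := hI.memA i
    rw [Bool.eq_iff_iff, this]
    simp [InA, currentValue]
  | B i =>
    have := hI.memB i
    simpa [WillClear, MayUnset] using this
  | flag1 => simpa [ReaderFlag1] using hI.flag1
  | flag2 => simpa [ReaderFlag2] using hI.flag2

/-! ## Linearization points -/

/-- Either the value and the uncommitted status persist, apart from a new invocation, or exactly
here the pending Write takes effect and supplies the new value. -/
theorem value_step (α : Execution (algorithm K v₀)) (t : ℕ) :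
    (valueAt α (t + 1) = valueAt α t ∧
      (∀ v, Uncommitted v (wr α t) → Uncommitted v (wr α (t + 1))) ∧
      ∀ v, Uncommitted v (wr α (t + 1)) →
        Uncommitted v (wr α t) ∨ α.Invokes t .writer (.write v)) ∨
    (Uncommitted (valueAt α (t + 1)) (wr α t) ∧ ∀ v, ¬ Uncommitted v (wr α (t + 1))) := by
  have h := trans_of_execution α t
  unfold valueAt Execution.Invokes
  generalize α.actions.get? t = act at *
  generalize α.resp t = o at *
  generalize (α.cfg t).mem = m at *
  generalize (α.cfg (t + 1)).mem = m' at *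
  generalize rd α t = r at *
  generalize rd α (t + 1) = r' at *
  generalize wr α t = w at *
  generalize wr α (t + 1) = w' at *
  cases h with
  | terminated => exact .inl ⟨rfl, fun _ h => h, fun _ h => .inl h⟩
  | invokeRead => exact .inl ⟨rfl, fun _ h => h, fun _ h => .inl h⟩
  | invokeWrite _ _ l v =>
    refine .inl ⟨rfl, fun _ h => h.elim, ?_⟩
    rintro v' ⟨rfl, -⟩
    exact .inr rfl
  | stepReader => exact .inl ⟨rfl, fun _ h => h, fun _ h => .inl h⟩
  | @stepWriter _ s _ _ _ _ h =>
    cases hs : s.committed with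
    | true =>
      obtain ⟨h1, h2⟩ := h.not_uncommitted hs
      refine .inl ⟨h2, fun v hv => ?_, fun v hv => absurd hv (h1 v)⟩
      rw [Uncommitted, hs] at hv
      cases hv.2
    | false =>
      rcases h.uncommitted_or hs with ⟨h1, h2⟩ | ⟨h1, h2⟩
      · refine .inl ⟨h2, ?_, ?_⟩
        · rintro v ⟨rfl, -⟩
          exact h1
        · intro v hv
          exact .inl ⟨h1.unique hv, hs⟩
      · exact .inr ⟨⟨h2.symm, hs⟩, h1⟩

theorem exists_invokes_of_uncommitted (α : Execution (algorithm K v₀)) {t : ℕ} {v : Fin K}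
    (h : Uncommitted v (wr α t)) : ∃ n, n < t ∧ α.Invokes n .writer (.write v) ∧
      ∀ u, n < u → u ≤ t → Uncommitted v (wr α u) := by
  induction t with
  | zero =>
    rw [wr_zero] at h
    cases h
  | succ t ih =>
    rcases value_step α t with ⟨-, -, h1⟩ | ⟨-, h1⟩
    · rcases h1 v h with h2 | h2
      · obtain ⟨n, hn, hinv, hu⟩ := ih h2
        refine ⟨n, by omega, hinv, fun u hu1 hu2 => ?_⟩
        rcases Nat.le_succ_iff.1 hu2 with h3 | rfl
        · exact hu u hu1 h3
        · exact h
      · refine ⟨t, by omega, h2, fun u hu1 hu2 => ?_⟩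
        rw [show u = t + 1 by omega]
        exact h
    · exact absurd h (h1 v)

/-- In its `t`-th action the Write of `v` invoked in the `n`-th action takes effect. -/
def WritePoint (α : Execution (algorithm K v₀)) (t n : ℕ) (v : Fin K) : Prop :=
  α.Invokes n .writer (.write v) ∧ n < t ∧ (∀ u, n < u → u ≤ t → Uncommitted v (wr α u)) ∧
    ∀ v', ¬ Uncommitted v' (wr α (t + 1))

/-- The `t`-th configuration is the first during the Read invoked in the `n`-th action in which
the register has the value `x` that this Read returns. -/
def ReadPoint (α : Execution (algorithm K v₀)) (t n : ℕ) (x : Fin K) : Prop :=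
  α.Invokes n .reader .read ∧ (∃ m, α.Returns n m (.value (some x)) ∧ t ≤ m) ∧ n < t ∧
    valueAt α t = x ∧ ∀ u, n < u → u < t → valueAt α u ≠ x

/-! ### Operations and their responses -/

section Generic

variable {P O R ι : Type} [DecidableEq P] [DecidableEq ι] {I : Implementation P O R ι}
  {α : Execution I}

theorem Execution.Invokes.unique {n : ℕ} {p p' : P} {o o' : O} (h : α.Invokes n p o)
    (h' : α.Invokes n p' o') : p = p' ∧ o = o' := by
  rw [Execution.Invokes] at h h'
  rw [h] at h'
  cases h'
  exact ⟨rfl, rfl⟩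

theorem Execution.Returns.of_invokes {n m : ℕ} {p : P} {o : O} {r : R} (h : α.Returns n m r)
    (hi : α.Invokes n p o) :
    n < m ∧ α.Responds m p r ∧ ∀ l r', n < l → l < m → ¬ α.Responds l p r' := by
  obtain ⟨p', o', hi', h⟩ := h
  obtain ⟨rfl, rfl⟩ := hi.unique hi'
  exact h

theorem Execution.Returns.unique {n m m' : ℕ} {r r' : R} (h : α.Returns n m r)
    (h' : α.Returns n m' r') : m = m' ∧ r = r' := by
  obtain ⟨p, o, hi, h1, h2, h3⟩ := h
  obtain ⟨h1', h2', h3'⟩ := h'.of_invokes hi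
  rcases lt_trichotomy m m' with hm | rfl | hm
  · exact absurd h2 (h3' m r h1 hm)
  · have := h2.2.symm.trans h2'.2
    exact ⟨rfl, Option.some.inj this⟩
  · exact absurd h2' (h3 m' r' h1' hm)

theorem Execution.cfg_of_terminatedAt {n k : ℕ} (hn : α.actions.TerminatedAt n) (hk : n ≤ k) :
    α.cfg k = α.cfg n := by
  induction k, hk using Nat.le_induction with
  | base => rfl
  | succ k hk ih =>
    rw [(Execution.cfg_stop α k (Stream'.Seq.terminated_stable _ hk hn)).1, ih]

end Generic

/-- The heart of linearizability for Reads: the invariant at `lower2` rules out `⊥` and says that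
the value was seen. -/
theorem responds_reader {α : Execution (algorithm K v₀)} {m : ℕ} {r : RegResp K}
    (h : α.Responds m .reader r) : ∃ x, r = .value (some x) ∧ Seen α m x := by
  have ht := trans_of_execution α m
  have hI := (inv_of_execution α m).reader
  rw [h.1, h.2] at ht
  generalize (α.cfg m).mem = M at *
  generalize (α.cfg (m + 1)).mem = M' at *
  generalize rd α m = R at *
  generalize rd α (m + 1) = R' at *
  generalize wr α m = W at *
  generalize wr α (m + 1) = W' at *
  cases ht with
  | stepReader _ h =>
    cases h with
    | lower2 x =>
      obtain ⟨y, rfl, hy⟩ := hI _ rfl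
      exact ⟨y, rfl, hy⟩

theorem responds_writer {α : Execution (algorithm K v₀)} {m : ℕ} {r : RegResp K}
    (h : α.Responds m .writer r) : r = .ack ∧ ∀ v, ¬ Uncommitted v (wr α (m + 1)) := by
  have ht := trans_of_execution α m
  rw [h.1, h.2] at ht
  generalize (α.cfg m).mem = M at *
  generalize (α.cfg (m + 1)).mem = M' at *
  generalize rd α m = R at *
  generalize rd α (m + 1) = R' at *
  generalize wr α m = W at *
  generalize wr α (m + 1) = W' at *
  cases ht with
  | stepWriter _ h => cases h <;> exact ⟨rfl, fun _ h => h⟩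

theorem invokes_reader {α : Execution (algorithm K v₀)} {n : ℕ} {o : RegOp K}
    (h : α.Invokes n .reader o) : o = .read ∧ rd α n = .inl () := by
  obtain ⟨s, a, h1, h2, -⟩ := h.loc
  cases o with
  | read => exact ⟨rfl, h1⟩
  | write v => cases h2

theorem invokes_writer {α : Execution (algorithm K v₀)} {n : ℕ} {o : RegOp K}
    (h : α.Invokes n .writer o) : ∃ v, o = .write v ∧ Uncommitted v (wr α (n + 1)) ∧
      ∀ v', ¬ Uncommitted v' (wr α n) := by
  obtain ⟨s, a, h1, h2, h3⟩ := h.loc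
  cases o with
  | read => cases h2
  | write v =>
    refine ⟨v, rfl, ?_, ?_⟩
    · cases h2
      change Uncommitted v ((α.cfg (n + 1)).loc .writer)
      rw [h3]
      exact ⟨rfl, rfl⟩
    · intro v' h'
      change Uncommitted v' ((α.cfg n).loc .writer) at h'
      rw [h1] at h'
      exact h'

theorem WritePoint.valueAt_eq {α : Execution (algorithm K v₀)} {t n : ℕ} {v : Fin K}
    (h : WritePoint α t n v) : valueAt α (t + 1) = v := by
  obtain ⟨-, h1, h2, h3⟩ := h
  have h4 := h2 t h1 le_rfl
  rcases value_step α t with ⟨-, h5, -⟩ | ⟨h5, -⟩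
  · exact absurd (h5 v h4) (h3 v)
  · exact h5.unique h4

theorem valueAt_succ_of_not_writePoint {α : Execution (algorithm K v₀)} {t : ℕ}
    (h : ∀ n v, ¬ WritePoint α t n v) : valueAt α (t + 1) = valueAt α t := by
  rcases value_step α t with ⟨h1, -⟩ | ⟨h1, h2⟩
  · exact h1
  · obtain ⟨n, hn, hi, hu⟩ := exists_invokes_of_uncommitted α h1
    exact absurd ⟨hi, hn, hu, h2⟩ (h n _)

theorem exists_writePoint {α : Execution (algorithm K v₀)} {n m : ℕ} {r : RegResp K} {v : Fin K}
    (hi : α.Invokes n .writer (.write v)) (hr : α.Returns n m r) : ∃ t, WritePoint α t n v := by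
  obtain ⟨hnm, hresp, -⟩ := hr.of_invokes hi
  obtain ⟨v', hv', hU, -⟩ := invokes_writer hi
  cases hv'
  -- The writer is no longer uncommitted after its return, so there is a first action that ends this
  -- status; it is the linearization point.
  have hex : ∃ u, n < u ∧ ¬ Uncommitted v (wr α (u + 1)) :=
    ⟨m, hnm, (responds_writer hresp).2 v⟩
  classical
  obtain ⟨h1, h2⟩ := Nat.find_spec hex
  have hmin : ∀ u, n < u → u ≤ Nat.find hex → Uncommitted v (wr α u) := by
    intro u hu hu'
    rcases Nat.lt_or_ge (n + 1) u with h3 | h3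
    · have := Nat.find_min hex (show u - 1 < Nat.find hex by omega)
      rw [Nat.sub_add_cancel (by omega)] at this
      by_contra h4
      exact this ⟨by omega, h4⟩
    · rw [show u = n + 1 by omega]
      exact hU
  refine ⟨Nat.find hex, hi, h1, hmin, ?_⟩
  rcases value_step α (Nat.find hex) with ⟨-, h5, -⟩ | ⟨-, h5⟩
  · exact absurd (h5 v (hmin _ h1 le_rfl)) h2
  · exact h5

theorem exists_readPoint {α : Execution (algorithm K v₀)} {n m : ℕ} {r : RegResp K}
    (hi : α.Invokes n .reader .read) (hr : α.Returns n m r) : ∃ t x, ReadPoint α t n x := by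
  obtain ⟨hnm, hresp, -⟩ := hr.of_invokes hi
  obtain ⟨x, rfl, s, hsm, hsx, hs⟩ := responds_reader hresp
  -- The reader is idle in the configuration `n`, whereas it is active throughout the interval
  -- witnessing that `x` was seen.
  have hns : n < s := by
    by_contra h
    obtain ⟨a, ha⟩ := hs n (by omega) hnm.le
    rw [(invokes_reader hi).2] at ha
    cases ha
  have hex : ∃ t, n < t ∧ valueAt α t = x := ⟨s, hns, hsx⟩
  classical
  obtain ⟨h1, h2⟩ := Nat.find_spec hex
  refine ⟨Nat.find hex, x, hi, ⟨m, hr, (Nat.find_min' hex ⟨hns, hsx⟩).trans hsm⟩, h1, h2, ?_⟩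
  exact fun u hu hu' hx => Nat.find_min hex hu' ⟨hu, hx⟩

/-- The linearization points: Reads linearize in configurations, Writes in actions. -/
def Point (α : Execution (algorithm K v₀)) (κ n : ℕ)
    (y : CompleteOp Proc (RegOp K) (RegResp K)) : Prop :=
  (∃ t v, κ = 2 * t + 1 ∧ y = ⟨.writer, .write v, .ack⟩ ∧ WritePoint α t n v) ∨
    ∃ t x, κ = 2 * t ∧ y = ⟨.reader, .read, .value (some x)⟩ ∧ ReadPoint α t n x

/-! ### Uniqueness of linearization points -/

theorem WritePoint.index_unique {α : Execution (algorithm K v₀)} {t n n' : ℕ} {v v' : Fin K}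
    (h : WritePoint α t n v) (h' : WritePoint α t n' v') : n = n' := by
  wlog hlt : n < n' generalizing n n' v v'
  · rcases (not_lt.1 hlt).lt_or_eq with h1 | h1
    · exact (this h' h h1).symm
    · exact h1.symm
  obtain ⟨-, -, -, hno⟩ := invokes_writer h'.1
  exact absurd (h.2.2.1 n' hlt h'.2.1.le) (hno v)

theorem ReadPoint.index_unique {α : Execution (algorithm K v₀)} {t n n' : ℕ} {x x' : Fin K}
    (h : ReadPoint α t n x) (h' : ReadPoint α t n' x') : n = n' := by
  wlog hlt : n < n' generalizing n n' x x'
  · rcases (not_lt.1 hlt).lt_or_eq with h1 | h1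
    · exact (this h' h h1).symm
    · exact h1.symm
  obtain ⟨hi, ⟨m, hr, htm⟩, -⟩ := h
  obtain ⟨a, ha⟩ := hi.active (hr.of_invokes hi).2.2 hlt (h'.2.2.1.le.trans htm)
  have := (invokes_reader h'.1).2
  rw [rd, ha] at this
  cases this

theorem WritePoint.time_unique {α : Execution (algorithm K v₀)} {t t' n : ℕ} {v v' : Fin K}
    (h : WritePoint α t n v) (h' : WritePoint α t' n v') : t = t' := by
  wlog hlt : t < t' generalizing t t' v v'
  · rcases (not_lt.1 hlt).lt_or_eq with h1 | h1
    · exact (this h' h h1).symm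
    · exact h1.symm
  exact absurd (h'.2.2.1 (t + 1) (h.2.1.trans (Nat.lt_succ_self t)) hlt) (h.2.2.2 v')

/-- The response fixes the value, and the point is the first configuration of the Read that has this
value. -/
theorem ReadPoint.time_unique {α : Execution (algorithm K v₀)} {t t' n : ℕ} {x x' : Fin K}
    (h : ReadPoint α t n x) (h' : ReadPoint α t' n x') : t = t' := by
  wlog hlt : t < t' generalizing t t' x x'
  · rcases (not_lt.1 hlt).lt_or_eq with h1 | h1
    · exact (this h' h h1).symm
    · exact h1.symm
  obtain ⟨-, ⟨m, hr, -⟩, hnt, hx, -⟩ := h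
  obtain ⟨-, ⟨m', hr', -⟩, -, -, hmin⟩ := h'
  have := (hr.unique hr').2
  simp only [RegResp.value.injEq, Option.some.injEq] at this
  exact absurd (hx.trans this) (hmin t hnt hlt)

/-- Every execution has a linearization; its final state is the eventual value of the register. -/
theorem exists_linearization (α : Execution (algorithm K v₀)) :
    ∃ H, IsLinearization (register K v₀) α H ∧
      ∀ q, FinalState (register K v₀) H q → ∃ N, ∀ t, N ≤ t → valueAt α t = q := by
  -- Keys `2 * t` and `2 * t + 1` share the state `valueAt α t`, so the state can change only across
  -- odd keys, where Writes are placed. Pending Reads get no point; pending Writes get one if they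
  -- have taken effect.
  suffices hs : ∃ H, IsLinearization (register K v₀) α H ∧
      ∀ q, FinalState (register K v₀) H q → ∃ N, ∀ κ, N ≤ κ → valueAt α (κ / 2) = q by
    obtain ⟨H, hH, hq⟩ := hs
    refine ⟨H, hH, fun q hf => ?_⟩
    obtain ⟨N, hN⟩ := hq q hf
    refine ⟨N, fun t ht => ?_⟩
    have := hN (2 * t) (by omega)
    rwa [Nat.mul_div_cancel_left t two_pos] at this
  refine exists_isLinearization_of_points (register K v₀) α (Point α)
    (fun κ => valueAt α (κ / 2)) ?_ ?_ ?_ ?_ ?_ ?_ ?_ ?_ ?_ ?_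
  · change currentValue (wr α 0) = v₀
    rw [wr_zero]
    rfl
  · intro κ hκ
    obtain ⟨t, rfl | rfl⟩ := Nat.even_or_odd' κ
    · congr 1
      omega
    · rw [show (2 * t + 1 + 1) / 2 = t + 1 by omega, show (2 * t + 1) / 2 = t by omega]
      exact valueAt_succ_of_not_writePoint fun n v h => hκ ⟨n, _, .inl ⟨t, v, rfl, rfl, h⟩⟩
  · rintro κ n y (⟨t, v, rfl, rfl, h⟩ | ⟨t, x, rfl, rfl, h⟩)
    · rw [show (2 * t + 1 + 1) / 2 = t + 1 by omega, h.valueAt_eq]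
      rfl
    · rw [show (2 * t + 1) / 2 = t by omega, show 2 * t / 2 = t by omega, h.2.2.2.1]
      rfl
  · rintro κ n y (⟨t, v, rfl, rfl, h⟩ | ⟨t, x, rfl, rfl, h⟩)
    · exact h.1
    · exact h.1
  · rintro κ n y m r (⟨t, v, rfl, rfl, h⟩ | ⟨t, x, rfl, rfl, h⟩) hr
    · exact (responds_writer (hr.of_invokes h.1).2.1).1.symm
    · obtain ⟨m', hr', -⟩ := h.2.1
      exact (hr'.unique hr).2
  · rintro κ n y n' y' (⟨t, v, rfl, rfl, h⟩ | ⟨t, x, rfl, rfl, h⟩)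
      (⟨t', v', ht, rfl, h'⟩ | ⟨t', x', ht, rfl, h'⟩)
    · obtain rfl : t = t' := by omega
      exact h.index_unique h'
    · omega
    · omega
    · obtain rfl : t = t' := by omega
      exact h.index_unique h'
  · rintro κ κ' n y y' (⟨t, v, rfl, rfl, h⟩ | ⟨t, x, rfl, rfl, h⟩)
      (⟨t', v', rfl, rfl, h'⟩ | ⟨t', x', rfl, rfl, h'⟩)
    · rw [h.time_unique h']
    · cases (h.1.unique h'.1).1
    · cases (h.1.unique h'.1).1
    · rw [h.time_unique h']
  · intro n m r hr
    obtain ⟨p, o, hi, -⟩ := id hr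
    cases p with
    | reader =>
      obtain ⟨rfl, -⟩ := invokes_reader hi
      obtain ⟨t, x, h⟩ := exists_readPoint hi hr
      exact ⟨_, _, .inr ⟨t, x, rfl, rfl, h⟩⟩
    | writer =>
      obtain ⟨v, rfl, -⟩ := invokes_writer hi
      obtain ⟨t, h⟩ := exists_writePoint hi hr
      exact ⟨_, _, .inl ⟨t, v, rfl, rfl, h⟩⟩
  · rintro κ n y (⟨t, v, rfl, rfl, h⟩ | ⟨t, x, rfl, rfl, h⟩)
    · have := h.2.1
      omega
    · have := h.2.2.1
      omega
  · rintro κ n y m r (⟨t, v, rfl, rfl, h⟩ | ⟨t, x, rfl, rfl, h⟩) hr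
    · obtain ⟨hnm, hresp, -⟩ := hr.of_invokes h.1
      by_contra hlt
      exact (responds_writer hresp).2 v (h.2.2.1 (m + 1) (by omega) (by omega))
    · obtain ⟨m', hr', htm⟩ := h.2.1
      have := (hr'.unique hr).1
      omega

/-! ### Quiescent history independence and conclusion -/

theorem quiescentHI_algorithm (K : ℕ) [NeZero K] (v₀ : Fin K) :
    QuiescentHI (register K v₀) (algorithm K v₀) := by
  choose h hlin hfin using fun α : Execution (algorithm K v₀) => exists_linearization α
  refine ⟨h, hlin, ?_⟩
  have key : ∀ (α : Execution (algorithm K v₀)) q C, (∃ C₀, α.EndsIn C₀ ∧ C₀.Quiescent) →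
      FinalState (register K v₀) (h α) q → α.EndsIn C →
      C.mem = fun c => decide (c = .A q) := by
    rintro α q C ⟨C₀, ⟨n₀, ht₀, rfl⟩, hC₀⟩ hq ⟨n, ht, rfl⟩
    obtain ⟨N, hN⟩ := hfin α q hq
    -- The two end indices may differ and the value may settle only after `N`; a common later index
    -- has the same configuration as both ends.
    have h1 := Execution.cfg_of_terminatedAt ht (show n ≤ max N (max n n₀) by omega)
    have h2 := Execution.cfg_of_terminatedAt ht₀ (show n₀ ≤ max N (max n n₀) by omega)
    funext c
    rw [← h1, mem_of_quiescent α _ (h2 ▸ hC₀), hN _ (le_max_left _ _)]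
  intro α hα α' hα' q C C' hq hq' hC hC'
  rw [key α q C hα hq hC, key α' q C' hα' hq' hC']

end HIReg

theorem mainTheorem5 (K : ℕ) [NeZero K] (v₀ : Fin K) :
    HIReg.Linearizable (HIReg.register K v₀) (HIReg.algorithm K v₀) ∧
    HIReg.WaitFree (HIReg.algorithm K v₀) ∧
    HIReg.QuiescentHI (HIReg.register K v₀) (HIReg.algorithm K v₀) ∧
    (∀ (α : HIReg.Execution (HIReg.algorithm K v₀)) (n : ℕ), (α.cfg n).Quiescent →
      (∀ j, (α.cfg n).mem (HIReg.Cell.B j) = false) ∧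
      (α.cfg n).mem HIReg.Cell.flag1 = false ∧
      (α.cfg n).mem HIReg.Cell.flag2 = false) := by
  refine ⟨fun α => (HIReg.exists_linearization α).imp fun _ h => h.1,
    HIReg.waitFree_algorithm K v₀, HIReg.quiescentHI_algorithm K v₀, fun α n hn => ?_⟩
  simp [HIReg.mem_of_quiescent α n hn]
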